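/- Let $X$ be a complex Banach space that is the direct sum $X=X_1\oplus\dots\oplus X_n$ of closed nonzero subspaces, and let $A$ be a bounded linear operator on $X$ whose operator matrix $\{A_{ij}\}$, $A_{ij}\colon X_j\to X_i$ bounded, is lower triangular ($A_{ij}=0$ for $i<j$). Let $\sigma(A)$ be the spectrum of $A$ in the algebra of all bounded operators on $X$, and let $\sigma^+(A)$ be its causal spectrum, i.e. its spectrum in the algebra of bounded operators with lower triangular matrix. For $\lambda\in\mathbb C$ and $t\in\mathbb R$, $t\ne0$, put $$\exp_{+,t}(\lambda)=\begin{cases}e^{\lambda t},&t>0,\\0,&t<0,\end{cases}\qquad \exp_{-,t}(\lambda)=\begin{cases}0,&t>0,\\-e^{\lambda t},&t<0,\end{cases}\qquad g_t(\lambda)=\begin{cases}\exp_{-,t}(\lambda),&\operatorname{Re}\lambda>0,\\ \exp_{+,t}(\lambda),&\operatorname{Re}\lambda<0.\end{cases}$$ For a bounded operator $T$ and a function $f$ analytic in a neighbourhood of $\sigma(T)$ let $f(T)=\frac1{2\pi i}\int_\Gamma f(\lambda)(\lambda\mathbf 1-T)^{-1}\,d\lambda$, where $\Gamma$ is a contour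 (a finite union of closed piecewise $C^1$ curves) that surrounds $\sigma(T)$ once counterclockwise and is such that $f$ is analytic on and inside $\Gamma$. For indices $i_1>i_2>\dots>i_m$, $m\ge1$, and a function $f$ analytic in a neighbourhood of $\sigma^+(A)$ let $$f^{[m-1]}(A;i_1,\dots,i_m)=\frac1{2\pi i}\int_\Gamma f(\lambda)(\lambda\mathbf 1-A_{i_1i_1})^{-1}A_{i_1i_2}(\lambda\mathbf 1-A_{i_2i_2})^{-1}A_{i_2i_3}\cdots A_{i_{m-1}i_m}(\lambda\mathbf 1-A_{i_mi_m})^{-1}\,d\lambda,$$ where $\Gamma$ is any contour that surrounds $\sigma^+(A)$ once counterclockwise and is such that $f$ is analytic on and inside $\Gamma$. Then the following objects are well defined (such contours exist, the integrals over $\Gamma$ do not depend on the choice of $\Gamma$, and the multiple integrals converge absolutely) and satisfy: for $t>0$, $$\exp_{+,t}^{[m-1]}(A;i_1,\dots,i_m)=\int_0^t\int_0^{s_{m-1}}\!\!\dots\int_0^{s_2}\exp_{+,s_1}(A_{i_1i_1})A_{i_1i_2}\exp_{+,s_2-s_1}(A_{i_2i_2})A_{i_2i_3}\cdots A_{i_{m-1}i_m}\exp_{+,t-s_{m-1}}(A_{i_mi_m})\,ds_1\dots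 ds_{m-1};$$ for $t<0$, $$\exp_{-,t}^{[m-1]}(A;i_1,\dots,i_m)=\int_t^0\int_{s_{m-1}}^0\!\!\dots\int_{s_2}^0\exp_{-,s_1}(A_{i_1i_1})A_{i_1i_2}\exp_{-,s_2-s_1}(A_{i_2i_2})A_{i_2i_3}\cdots A_{i_{m-1}i_m}\exp_{-,t-s_{m-1}}(A_{i_mi_m})\,ds_1\dots ds_{m-1};$$ and, if $\sigma(A)$ is disjoint from the imaginary axis, for $t\ne0$, $$g_t^{[m-1]}(A;i_1,\dots,i_m)=\int_{-\infty}^{\infty}\!\!\dots\int_{-\infty}^{\infty}g_{s_1}(A_{i_1i_1})A_{i_1i_2}\,g_{s_2-s_1}(A_{i_2i_2})A_{i_2i_3}\cdots A_{i_{m-1}i_m}\,g_{t-s_{m-1}}(A_{i_mi_m})\,ds_1\dots ds_{m-1}.$$ For $m=1$ the right-hand sides mean $\exp_{+,t}(A_{i_1i_1})$, $\exp_{-,t}(A_{i_1i_1})$ and $g_t(A_{i_1i_1})$, respectively. -/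

import Mathlib

open MeasureTheory Set

noncomputable section

/-- A decomposition `X = X₁ ⊕ ⋯ ⊕ Xₙ` of a normed space into the (algebraic) direct sum of finitely
many closed nonzero subspaces, indexed here by `Fin n`. -/
structure BlockDecomp (X : Type*) [NormedAddCommGroup X] [NormedSpace ℂ X] (n : ℕ) where
  S : Fin n → Submodule ℂ X
  isClosed : ∀ i, IsClosed (S i : Set X)
  ne_bot : ∀ i, S i ≠ ⊥
  isInternal : DirectSum.IsInternal S

namespace BlockDecomp

/-- The summand `X_i`, as a normed space with the norm of `X`. -/
def Summand {X : Type*} [NormedAddCommGroup X] [NormedSpace ℂ X] {n : ℕ} (D : BlockDecomp X n)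
    (i : Fin n) : Type _ := D.S i

instance {X : Type*} [NormedAddCommGroup X] [NormedSpace ℂ X] {n : ℕ} (D : BlockDecomp X n)
    (i : Fin n) : NormedAddCommGroup (D.Summand i) :=
  inferInstanceAs (NormedAddCommGroup (D.S i))

instance {X : Type*} [NormedAddCommGroup X] [NormedSpace ℂ X] {n : ℕ} (D : BlockDecomp X n)
    (i : Fin n) : NormedSpace ℂ (D.Summand i) :=
  inferInstanceAs (NormedSpace ℂ (D.S i))

instance {X : Type*} [NormedAddCommGroup X] [NormedSpace ℂ X] [CompleteSpace X] {n : ℕ}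
    (D : BlockDecomp X n) (i : Fin n) : CompleteSpace (D.Summand i) :=
  (D.isClosed i).completeSpace_coe

variable {X : Type*} [NormedAddCommGroup X] [NormedSpace ℂ X] {n : ℕ}

/-- The inclusion `X_i → X`. -/
def incl (D : BlockDecomp X n) (i : Fin n) : D.Summand i →L[ℂ] X := (D.S i).subtypeL

/-- The map `(x₁, …, xₙ) ↦ x₁ + ⋯ + xₙ`. -/
def sumMap (D : BlockDecomp X n) : (∀ i, D.Summand i) →L[ℂ] X :=
  ∑ i, D.incl i ∘L ContinuousLinearMap.proj i

theorem sumMap_apply (D : BlockDecomp X n) (x : ∀ i, D.Summand i) :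
    D.sumMap x = ∑ i, D.incl i (x i) := by
  simp [sumMap]

theorem sumMap_bijective (D : BlockDecomp X n) : Function.Bijective D.sumMap := by
  classical
  have h := D.isInternal
  let e := DirectSum.linearEquivFunOnFintype ℂ (Fin n) (fun i => D.S i)
  have h2 : ∀ y, D.sumMap (e y) = DirectSum.coeAddMonoidHom D.S y := by
    intro y
    refine (D.sumMap_apply (e y)).trans ?_
    rw [DirectSum.coeAddMonoidHom_eq_dfinsuppSum, DFinsupp.sum_eq_sum_fintype _ (by simp)]
    rfl
  have h3 : (fun y => D.sumMap (e y)) = DirectSum.coeAddMonoidHom D.S := funext h2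
  have h4 : Function.Bijective ((D.sumMap : (∀ i, D.Summand i) → X) ∘ e) := by
    change Function.Bijective (fun y => D.sumMap (e y))
    rw [h3]
    exact h
  exact (Function.Bijective.of_comp_iff _ e.bijective).1 h4

variable [CompleteSpace X]

/-- The topological isomorphism `X₁ × ⋯ × Xₙ ≃ X`, `(x₁, …, xₙ) ↦ x₁ + ⋯ + xₙ`. -/
def sumEquiv (D : BlockDecomp X n) : (∀ i, D.Summand i) ≃L[ℂ] X :=
  ContinuousLinearEquiv.ofBijective D.sumMap
    (LinearMap.ker_eq_bot.2 D.sumMap_bijective.1) (LinearMap.range_eq_top.2 D.sumMap_bijective.2)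

/-- The `i`-th component `x ↦ xᵢ` of the decomposition `x = x₁ + ⋯ + xₙ`. -/
def component (D : BlockDecomp X n) (i : Fin n) : X →L[ℂ] D.Summand i :=
  ContinuousLinearMap.proj i ∘L (D.sumEquiv.symm : X →L[ℂ] ∀ i, D.Summand i)

theorem sum_component (D : BlockDecomp X n) (x : X) :
    ∑ i, D.incl i (D.component i x) = x := by
  rw [← D.sumMap_apply (fun i => D.component i x)]
  exact D.sumEquiv.apply_symm_apply x

theorem component_incl (D : BlockDecomp X n) (i j : Fin n) (x : D.Summand j) :
    D.component i (D.incl j x) = Pi.single (M := fun i => D.Summand i) j x i := by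
  have h : D.sumEquiv (Pi.single j x) = D.incl j x := by
    change D.sumMap _ = _
    rw [sumMap_apply, Finset.sum_eq_single j]
    · simp
    · intro k _ hk
      simp [Pi.single_eq_of_ne hk]
    · simp
  rw [← h]
  change D.sumEquiv.symm (D.sumEquiv _) i = _
  rw [ContinuousLinearEquiv.symm_apply_apply]

/-- The entry `T_{ij} : X_j → X_i` of the operator matrix of `T : X → X`. -/
def block (D : BlockDecomp X n) (T : X →L[ℂ] X) (i j : Fin n) : D.Summand j →L[ℂ] D.Summand i :=
  D.component i ∘L T ∘L D.incl j

theorem block_mul (D : BlockDecomp X n) (T U : X →L[ℂ] X) (i j : Fin n) :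
    D.block (T * U) i j = ∑ k, D.block T i k ∘L D.block U k j := by
  ext1 x
  have h := D.sum_component (U (D.incl j x))
  simp only [block, ContinuousLinearMap.comp_apply, mul_apply_eq_comp, sum_apply]
  conv_lhs => rw [← h]
  simp [map_sum]

/-- The algebra of causal operators: those `T` on `X` whose matrix `(T_{ij})` is lower
triangular. -/
def causal (D : BlockDecomp X n) : Subalgebra ℂ (X →L[ℂ] X) where
  carrier := {T | ∀ i j, i < j → D.block T i j = 0}
  mul_mem' := by
    intro T U hT hU i j hij
    rw [block_mul]
    refine Finset.sum_eq_zero fun k _ => ?_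
    rcases lt_or_ge i k with h | h
    · rw [hT i k h, ContinuousLinearMap.zero_comp]
    · rw [hU k j (h.trans_lt hij), ContinuousLinearMap.comp_zero]
  add_mem' := by
    intro T U hT hU i j hij
    have h : D.block (T + U) i j = D.block T i j + D.block U i j := by
      ext1 x; simp [block]
    rw [h, hT i j hij, hU i j hij, add_zero]
  algebraMap_mem' := by
    intro c i j hij
    ext1 x
    simp [block, Algebra.algebraMap_eq_smul_one, component_incl, Pi.single_eq_of_ne hij.ne]

/-- The product `Φ₁ T_{i₁i₂} Φ₂ T_{i₂i₃} ⋯ T_{i_{m-1}i_m} Φ_m` with `m = k + 1`, where `Φ_j` is an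
operator on `X_{i_j}`. -/
def chain (D : BlockDecomp X n) (T : X →L[ℂ] X) :
    (k : ℕ) → (idx : Fin (k + 1) → Fin n) →
      ((j : Fin (k + 1)) → (D.Summand (idx j) →L[ℂ] D.Summand (idx j))) →
        (D.Summand (idx (Fin.last k)) →L[ℂ] D.Summand (idx 0))
  | 0, _, Φ => Φ 0
  | k + 1, idx, Φ =>
      Φ 0 ∘L D.block T (idx 0) (idx (Fin.succ 0)) ∘L
        D.chain T k (fun j => idx j.succ) (fun j => Φ j.succ)

end BlockDecomp

/-- A contour: a finite union of closed piecewise continuously differentiable oriented curves in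
the complex plane, given by finitely many `C¹` arcs (restricted to the parameter interval `[0, 1]`)
and a permutation `next` such that each arc `j` ends where the arc `next j` begins. -/
structure Contour where
  N : ℕ
  arc : Fin N → ℝ → ℂ
  contDiff : ∀ j, ContDiff ℝ 1 (arc j)
  next : Equiv.Perm (Fin N)
  closed : ∀ j, arc j 1 = arc (next j) 0

namespace Contour

/-- The set of points of a contour. -/
def support (Γ : Contour) : Set ℂ := ⋃ j, Γ.arc j '' Icc 0 1

/-- The contour integral `∫_Γ F(z) dz`. -/
def integral {E : Type*} [NormedAddCommGroup E] [NormedSpace ℂ E] (Γ : Contour) (F : ℂ → E) : E :=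
  ∑ j, ∫ u in (0 : ℝ)..1, deriv (Γ.arc j) u • F (Γ.arc j u)

/-- The winding number of `Γ` about a point `z` that does not lie on `Γ`. -/
def index (Γ : Contour) (z : ℂ) : ℂ :=
  (2 * Real.pi * Complex.I)⁻¹ * Γ.integral fun w => (w - z)⁻¹

/-- `Γ` surrounds the set `K` counterclockwise (it avoids `K` and winds exactly once about each
point of `K`), and `f` is analytic on and inside `Γ`. -/
def Surrounds (Γ : Contour) (f : ℂ → ℂ) (K : Set ℂ) : Prop :=
  Disjoint Γ.support K ∧ (∀ z ∈ K, Γ.index z = 1) ∧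
    ∀ z, z ∈ Γ.support ∨ Γ.index z ≠ 0 → AnalyticAt ℂ f z

end Contour

open Classical in
/-- The analytic function `f` of an operator `T`:
`f(T) = (2πi)⁻¹ ∫_Γ f(z) (z - T)⁻¹ dz`, where `Γ` surrounds the spectrum of `T` and `f` is analytic
on and inside `Γ`. -/
def opFun {V : Type*} [NormedAddCommGroup V] [NormedSpace ℂ V] (f : ℂ → ℂ) (T : V →L[ℂ] V) :
    V →L[ℂ] V :=
  if h : ∃ Γ : Contour, Γ.Surrounds f (spectrum ℂ T) then
    (2 * Real.pi * Complex.I)⁻¹ • h.choose.integral fun z => f z • resolvent T z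
  else 0

/-- `exp_{+,t}` (undefined at `t = 0` in the literature; the value `0` is used there). -/
def expPlus (t : ℝ) (z : ℂ) : ℂ := if 0 < t then Complex.exp (z * t) else 0

/-- `exp_{-,t}` (undefined at `t = 0` in the literature; the value `0` is used there). -/
def expMinus (t : ℝ) (z : ℂ) : ℂ := if t < 0 then -Complex.exp (z * t) else 0

/-- `g_t` (undefined at `t = 0` and on the imaginary axis in the literature; the value `0` is used
there, so that `g_t`, `t ≠ 0`, is analytic exactly off the imaginary axis). -/
def greenFun (t : ℝ) (z : ℂ) : ℂ :=
  if 0 < z.re then expMinus t z else if z.re < 0 then expPlus t z else 0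

namespace BlockDecomp

variable {X : Type*} [NormedAddCommGroup X] [NormedSpace ℂ X] [CompleteSpace X] {n : ℕ}

/-- The operator divided difference
`f^{[m-1]}(A; i₁, …, i_m) = (2πi)⁻¹ ∫_Γ f(z) (z - A_{i₁i₁})⁻¹ A_{i₁i₂} (z - A_{i₂i₂})⁻¹ ⋯
A_{i_{m-1}i_m} (z - A_{i_mi_m})⁻¹ dz`, with `m = k + 1`, is well defined and has the value `L`:
there is a contour `Γ` that surrounds the causal spectrum of `A` (its spectrum in the algebra of
causal operators) such that `f` is analytic on and inside `Γ`, and for every such contour the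
integral has the value `L`. -/
def HasDividedDifference (D : BlockDecomp X n) (f : ℂ → ℂ) (A : D.causal) {k : ℕ}
    (idx : Fin (k + 1) → Fin n) (L : D.Summand (idx (Fin.last k)) →L[ℂ] D.Summand (idx 0)) : Prop :=
  (∃ Γ : Contour, Γ.Surrounds f (spectrum ℂ A)) ∧
    ∀ Γ : Contour, Γ.Surrounds f (spectrum ℂ A) →
      ((2 * Real.pi * Complex.I)⁻¹ • Γ.integral fun z =>
        f z • D.chain (A : X →L[ℂ] X) k idx fun j =>
          resolvent (D.block (A : X →L[ℂ] X) (idx j) (idx j)) z) = L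

/-- For a family of functions `f_t`, the product
`f_{s₁}(A_{i₁i₁}) A_{i₁i₂} f_{s₂-s₁}(A_{i₂i₂}) ⋯ A_{i_{m-1}i_m} f_{t-s_{m-1}}(A_{i_mi_m})`
as a function of `s = (s₁, …, s_{m-1})`, with `m = k + 1`. -/
def convIntegrand (D : BlockDecomp X n) (f : ℝ → ℂ → ℂ) (A : D.causal) {k : ℕ}
    (idx : Fin (k + 1) → Fin n) (t : ℝ) (s : Fin k → ℝ) :
    D.Summand (idx (Fin.last k)) →L[ℂ] D.Summand (idx 0) :=
  let p : Fin (k + 2) → ℝ := Fin.cons (α := fun _ => ℝ) 0 (Fin.snoc (α := fun _ => ℝ) s t)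
  D.chain (A : X →L[ℂ] X) k idx fun j =>
    opFun (f (p j.succ - p j.castSucc)) (D.block (A : X →L[ℂ] X) (idx j) (idx j))

end BlockDecomp

section Iterated

variable {E : Type*} [NormedAddCommGroup E] [NormedSpace ℝ E]

/-- `∫₀ᵗ ∫₀^{s_k} ⋯ ∫₀^{s₂} F(s₁, …, s_k) ds₁ ⋯ ds_k`. -/
def iterIntegralPos : (k : ℕ) → ((Fin k → ℝ) → E) → ℝ → E
  | 0, F, _ => F Fin.elim0
  | k + 1, F, t =>
      ∫ r in (0 : ℝ)..t, iterIntegralPos k (fun s => F (Fin.snoc (α := fun _ => ℝ) s r)) r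

/-- `∫ₜ⁰ ∫_{s_k}⁰ ⋯ ∫_{s₂}⁰ F(s₁, …, s_k) ds₁ ⋯ ds_k`. -/
def iterIntegralNeg : (k : ℕ) → ((Fin k → ℝ) → E) → ℝ → E
  | 0, F, _ => F Fin.elim0
  | k + 1, F, t =>
      ∫ r in t..(0 : ℝ), iterIntegralNeg k (fun s => F (Fin.snoc (α := fun _ => ℝ) s r)) r

/-- `∫_{-∞}^{∞} ⋯ ∫_{-∞}^{∞} F(s₁, …, s_k) ds₁ ⋯ ds_k`. -/
def iterIntegral : (k : ℕ) → ((Fin k → ℝ) → E) → E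
  | 0, F => F Fin.elim0
  | k + 1, F => ∫ r : ℝ, iterIntegral k (fun s => F (Fin.snoc (α := fun _ => ℝ) s r))

end Iterated

end

open Filter Topology Interval

noncomputable section

/-! ### Contour integrals and the winding number. -/

namespace Contour

variable {E : Type*} [NormedAddCommGroup E] [NormedSpace ℂ E]

/-! The three formulas are instances of one convolution theorem. Suppose the causal spectrum `K` is
covered by a left and a right open disc whose closures are separated by a vertical line, and `f_t`
equals `exp_{+,t}` on the left disc and `exp_{-,t}` on the right one (`ExpSplit`). For `F`
holomorphic off `K`, the Cauchy integral of `f_t F` is `S.eval F t`: the left circle contributes for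
`t > 0`, the right circle, with a minus sign, for `t < 0`. A disc may degenerate to a point; this
gives `exp_+` and `exp_-`, while two genuine discs give `g`.

The core is `ExpSplit.eval_comp_eq_integral`: convolving the transforms of `C` and of a resolvent
`R(z) = (z - T)⁻¹` gives the transform of `Φ = C B R`. Write `E_a F(s)`, `E_b F(s)` for the
integrals of `e^{zs} F` over the two circles. From `zΦ = ΦT + CB` and `zR = TR + 1`, the products `E
Φ(s) E R(t - s)` have derivative `E C(s) B E R(t - s)`, for any choice of circles. So the
convolution has an explicit antiderivative on each of the three intervals cut out by `0` and `t`.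
Since `zR → 1` and `zΦ → 0` at infinity, `E_a R(0) + E_b R(0) = 1` and `E_a Φ(0) + E_b Φ(0) = 0`,
and the boundary terms collapse to the transform of `Φ` at `t`. Induction on the length of the
chain, peeling off the last factor, gives the multiple integrals; absolute convergence comes from
the bound `e^{ct - δ|t|}` on the transforms.

Two supporting facts are needed. Independence of the contour is the homology form of Cauchy's
theorem, proved by Dixon's argument (`Contour.integral_eq_of_index_eq`). As for spectra, taking a
diagonal block is an algebra homomorphism on causal operators, so the block spectra lie in the
causal spectrum; and the causal spectrum can add to `σ(A)` only points of bounded components of its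
complement, hence cannot meet an imaginary axis that avoids `σ(A)`. -/

theorem arc_mem_support (Γ : Contour) (j : Fin Γ.N) {u : ℝ} (hu : u ∈ Icc (0 : ℝ) 1) :
    Γ.arc j u ∈ Γ.support :=
  mem_iUnion.2 ⟨j, u, hu, rfl⟩

theorem isCompact_support (Γ : Contour) : IsCompact Γ.support :=
  isCompact_iUnion fun j => isCompact_Icc.image (Γ.contDiff j).continuous

theorem continuous_deriv_arc (Γ : Contour) (j : Fin Γ.N) : Continuous (deriv (Γ.arc j)) :=
  (Γ.contDiff j).continuous_deriv le_rfl

theorem hasDerivAt_arc (Γ : Contour) (j : Fin Γ.N) (u : ℝ) :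
    HasDerivAt (Γ.arc j) (deriv (Γ.arc j) u) u :=
  ((Γ.contDiff j).differentiable one_ne_zero u).hasDerivAt

theorem continuousOn_comp_arc (Γ : Contour) (j : Fin Γ.N) {F : ℂ → E}
    (hF : ContinuousOn F Γ.support) :
    ContinuousOn (fun u => deriv (Γ.arc j) u • F (Γ.arc j u)) (Icc 0 1) :=
  (Γ.continuous_deriv_arc j).continuousOn.smul
    (hF.comp (Γ.contDiff j).continuous.continuousOn fun _ hu => Γ.arc_mem_support j hu)

theorem intervalIntegrable_arc (Γ : Contour) (j : Fin Γ.N) {F : ℂ → E}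
    (hF : ContinuousOn F Γ.support) :
    IntervalIntegrable (fun u => deriv (Γ.arc j) u • F (Γ.arc j u)) volume 0 1 :=
  ContinuousOn.intervalIntegrable (by simpa using Γ.continuousOn_comp_arc j hF)

theorem integral_congr (Γ : Contour) {F G : ℂ → E} (h : ∀ w ∈ Γ.support, F w = G w) :
    Γ.integral F = Γ.integral G := by
  refine Finset.sum_congr rfl fun j _ => intervalIntegral.integral_congr fun u hu => ?_
  simp only [h _ (Γ.arc_mem_support j (by simpa using hu))]

theorem integral_sub (Γ : Contour) {F G : ℂ → E} (hF : ContinuousOn F Γ.support)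
    (hG : ContinuousOn G Γ.support) :
    (Γ.integral fun w => F w - G w) = Γ.integral F - Γ.integral G := by
  simp only [integral, smul_sub, ← Finset.sum_sub_distrib]
  exact Finset.sum_congr rfl fun j _ =>
    intervalIntegral.integral_sub (Γ.intervalIntegrable_arc j hF) (Γ.intervalIntegrable_arc j hG)

theorem integral_smul_const [CompleteSpace E] (Γ : Contour) (f : ℂ → ℂ) (x : E) :
    (Γ.integral fun w => f w • x) = Γ.integral f • x := by
  simp only [integral, Finset.sum_smul]
  refine Finset.sum_congr rfl fun j _ => ?_
  rw [← intervalIntegral.integral_smul_const]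
  simp [smul_smul]

theorem exists_norm_integral_le (Γ : Contour) : ∃ L : ℝ, 0 ≤ L ∧ ∀ (F : ℂ → E) (M : ℝ),
    (∀ w ∈ Γ.support, ‖F w‖ ≤ M) → ‖Γ.integral F‖ ≤ L * M := by
  choose C hC using fun j => (isCompact_Icc (a := (0 : ℝ)) (b := 1)).exists_bound_of_continuousOn
    (Γ.continuous_deriv_arc j).continuousOn
  have hC0 : ∀ j, 0 ≤ C j := fun j => (norm_nonneg _).trans (hC j 0 (by simp))
  refine ⟨∑ j, C j, Finset.sum_nonneg fun j _ => hC0 j, fun F M hM => ?_⟩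
  rw [Finset.sum_mul]
  refine (norm_sum_le _ _).trans (Finset.sum_le_sum fun j _ => ?_)
  have := intervalIntegral.norm_integral_le_of_norm_le_const (a := (0 : ℝ)) (b := 1) (C := C j * M)
    (f := fun u => deriv (Γ.arc j) u • F (Γ.arc j u)) fun u hu => by
      have hu' : u ∈ Icc (0 : ℝ) 1 := Ioc_subset_Icc_self (by simpa using hu)
      rw [norm_smul]
      exact mul_le_mul (hC j u hu') (hM _ (Γ.arc_mem_support j hu')) (norm_nonneg _) (hC0 j)
  simpa using this

/-- The integral of a derivative over a contour vanishes. -/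
theorem integral_eq_zero_of_hasDerivAt [CompleteSpace E] (Γ : Contour) {F F' : ℂ → E}
    (h : ∀ w ∈ Γ.support, HasDerivAt F (F' w) w) (hF' : ContinuousOn F' Γ.support) :
    Γ.integral F' = 0 := by
  have key : ∀ j, (∫ u in (0 : ℝ)..1, deriv (Γ.arc j) u • F' (Γ.arc j u)) =
      F (Γ.arc j 1) - F (Γ.arc j 0) := fun j =>
    intervalIntegral.integral_eq_sub_of_hasDerivAt (f := fun u => F (Γ.arc j u))
      (fun u hu => (h _ (Γ.arc_mem_support j (by simpa using hu))).scomp u (Γ.hasDerivAt_arc j u))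
      (Γ.intervalIntegrable_arc j hF')
  rw [integral, Finset.sum_congr rfl fun j _ => key j, Finset.sum_sub_distrib, sub_eq_zero]
  simp only [Γ.closed]
  exact Equiv.sum_comp Γ.next fun j => F (Γ.arc j 0)

theorem continuousOn_inv_sub {S : Set ℂ} {z : ℂ} (hz : z ∉ S) :
    ContinuousOn (fun w => (w - z)⁻¹) S :=
  (continuousOn_id.sub continuousOn_const).inv₀ fun w hw =>
    sub_ne_zero.2 fun h : w = z => hz (h ▸ hw)

theorem eventually_notMem_support (Γ : Contour) {z₀ : ℂ} (hz₀ : z₀ ∉ Γ.support) :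
    ∀ᶠ z in 𝓝 z₀, z ∉ Γ.support :=
  Γ.isCompact_support.isClosed.isOpen_compl.mem_nhds hz₀

/-- The difference of the two Cauchy kernels has the antiderivative `log ((w - z) / (w - z₀))`. The
principal branch serves on all of the contour once `z` is nearer to `z₀` than the contour is,
because the quotient then stays within distance one of `1`. -/
theorem eventually_index_eq (Γ : Contour) {z₀ : ℂ} (hz₀ : z₀ ∉ Γ.support) :
    ∀ᶠ z in 𝓝 z₀, Γ.index z = Γ.index z₀ := by
  obtain ⟨r, hr, hball⟩ := Metric.eventually_nhds_iff.1 (Γ.eventually_notMem_support hz₀)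
  refine Metric.eventually_nhds_iff.2 ⟨r, hr, fun z hz => ?_⟩
  rw [index, index, ← sub_eq_zero, ← mul_sub, ← integral_sub _
    (continuousOn_inv_sub (hball hz)) (continuousOn_inv_sub hz₀)]
  refine mul_eq_zero_of_right _ (Γ.integral_eq_zero_of_hasDerivAt
    (F := fun w => Complex.log ((w - z) / (w - z₀))) (fun w hw => ?_)
    ((continuousOn_inv_sub (hball hz)).sub (continuousOn_inv_sub hz₀)))
  have h0 : w - z₀ ≠ 0 := sub_ne_zero.2 fun h => hz₀ (h ▸ hw)
  have h1 : w - z ≠ 0 := sub_ne_zero.2 fun h => hball hz (h ▸ hw)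
  have hd : dist z z₀ < ‖w - z₀‖ := by
    by_contra! hcon
    exact hball (y := w) (by rw [dist_eq_norm]; exact hcon.trans_lt hz) hw
  have hmem : (w - z) / (w - z₀) ∈ Complex.slitPlane := by
    have : (w - z) / (w - z₀) = 1 + (z₀ - z) / (w - z₀) := by field_simp; ring
    rw [this]
    refine Complex.mem_slitPlane_of_norm_lt_one ?_
    rw [norm_div, div_lt_one (norm_pos_iff.2 h0), ← dist_eq_norm, dist_comm]
    exact hd
  have := ((((hasDerivAt_id w).sub_const z).div ((hasDerivAt_id w).sub_const z₀) h0)).clog hmem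
  refine this.congr_deriv ?_
  have h4 : ((fun x : ℂ => id x - z) / fun x => id x - z₀) w = (w - z) / (w - z₀) := rfl
  rw [h4]
  simp only [id]
  field_simp

/-- For `z` beyond the contour, `log (1 - w / z)` is an antiderivative of the kernel on the whole
contour. -/
theorem exists_index_eq_zero (Γ : Contour) : ∃ R : ℝ, 0 < R ∧ (∀ w ∈ Γ.support, ‖w‖ < R) ∧
    ∀ z, R ≤ ‖z‖ → Γ.index z = 0 := by
  obtain ⟨R, hR0, hR⟩ := Γ.isCompact_support.isBounded.exists_pos_norm_lt
  refine ⟨R, hR0, hR, fun z hz => ?_⟩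
  have hz0 : z ≠ 0 := norm_pos_iff.1 (hR0.trans_le hz)
  have hzs : z ∉ Γ.support := fun h => (hR z h).not_ge hz
  refine mul_eq_zero_of_right _ (Γ.integral_eq_zero_of_hasDerivAt
    (F := fun w => Complex.log (1 + -(w / z))) (fun w hw => ?_) (continuousOn_inv_sub hzs))
  have hmem : 1 + -(w / z) ∈ Complex.slitPlane := by
    refine Complex.mem_slitPlane_of_norm_lt_one ?_
    rw [norm_neg, norm_div, div_lt_one (norm_pos_iff.2 hz0)]
    exact (hR w hw).trans_le hz
  have h1 : w - z ≠ 0 := sub_ne_zero.2 fun h => hzs (h ▸ hw)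
  have := ((((hasDerivAt_id w).div_const z).neg).const_add 1).clog hmem
  refine this.congr_deriv ?_
  have h2 : 1 + -(w / z) ≠ 0 := Complex.slitPlane_ne_zero hmem
  have h3 : z - w ≠ 0 := fun h => h1 (by rw [← neg_sub, h, neg_zero])
  have h4 : (1 + (-fun x : ℂ => id x / z) w) = 1 + -(w / z) := rfl
  rw [h4, div_eq_iff h2]
  field_simp
  ring

/-- A contour integral depends holomorphically on a parameter. -/
theorem differentiableAt_integral [CompleteSpace E] (Γ : Contour) {Φ : ℂ → ℂ → E} {z₀ : ℂ}
    {s : Set ℂ} (hs : s ∈ 𝓝 z₀) (hc : ContinuousOn (Function.uncurry Φ) (s ×ˢ Γ.support))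
    (hd : ∀ w ∈ Γ.support, DifferentiableOn ℂ (fun z => Φ z w) s) :
    DifferentiableAt ℂ (fun z => Γ.integral (Φ z)) z₀ := by
  obtain ⟨r, hr, hrs⟩ := Metric.nhds_basis_closedBall.mem_iff.1 hs
  have hcz : ∀ z ∈ s, ContinuousOn (Φ z) Γ.support := fun z hz =>
    hc.comp (continuousOn_const.prodMk continuousOn_id) fun w hw => ⟨hz, hw⟩
  obtain ⟨M, hM⟩ := ((isCompact_closedBall z₀ r).prod
    Γ.isCompact_support).exists_bound_of_continuousOn
      (hc.mono (prod_mono hrs le_rfl))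
  have hr2 : 0 < r / 2 := by positivity
  have hsub : ∀ z ∈ Metric.ball z₀ (r / 2), Metric.closedBall z (r / 2) ⊆ Metric.closedBall z₀ r :=
    fun z hz => Metric.closedBall_subset_closedBall' (by
      have := Metric.mem_ball.1 hz; linarith)
  have hda : ∀ w ∈ Γ.support, ∀ z ∈ Metric.ball z₀ (r / 2),
      HasDerivAt (fun z => Φ z w) (deriv (fun z => Φ z w) z) z := fun w hw z hz =>
    ((hd w hw).differentiableAt (mem_of_superset (Metric.closedBall_mem_nhds z hr2)
      ((hsub z hz).trans hrs))).hasDerivAt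
  -- Cauchy's estimate on discs of radius `r / 2`, which stay in the disc of radius `r` where `Φ` is
  -- bounded by `M`; this is the majorant for differentiating under the integral.
  have hbd : ∀ w ∈ Γ.support, ∀ z ∈ Metric.ball z₀ (r / 2),
      ‖deriv (fun z => Φ z w) z‖ ≤ M / (r / 2) := fun w hw z hz =>
    Complex.norm_deriv_le_of_forall_mem_sphere_norm_le hr2
      (((hd w hw).mono ((hsub z hz).trans hrs)).diffContOnCl_ball le_rfl)
      fun y hy => hM (y, w) ⟨hsub z hz (Metric.sphere_subset_closedBall hy), hw⟩
  unfold integral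
  refine DifferentiableAt.fun_sum fun j _ => ?_
  have hmem : ∀ {u : ℝ}, u ∈ Ι (0 : ℝ) 1 → Γ.arc j u ∈ Γ.support := fun {u} hu =>
    Γ.arc_mem_support j (Ioc_subset_Icc_self (by simpa using hu))
  have hz₀ : z₀ ∈ Metric.ball z₀ (r / 2) := Metric.mem_ball_self hr2
  refine (intervalIntegral.hasDerivAt_integral_of_dominated_loc_of_deriv_le
    (F' := fun z u => deriv (Γ.arc j) u • deriv (fun z => Φ z (Γ.arc j u)) z)
    (bound := fun u => ‖deriv (Γ.arc j) u‖ * (M / (r / 2)))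
    (Metric.ball_mem_nhds z₀ hr2) ?_ ?_ ?_ ?_ ?_ ?_).2.differentiableAt
  · filter_upwards [hs] with z hz
    exact (Γ.intervalIntegrable_arc j (hcz z hz)).def'.aestronglyMeasurable
  · exact Γ.intervalIntegrable_arc j (hcz z₀ (mem_of_mem_nhds hs))
  -- Measurability of the derivative in the curve parameter: it is the pointwise limit of the
  -- difference quotients along a sequence `q n → z₀`, each of which is continuous on the contour.
  · let q : ℕ → ℂ := fun n => z₀ + (1 / ((n : ℝ) + 1) : ℝ)
    have hq0 : Tendsto (fun n : ℕ => ((1 / ((n : ℝ) + 1) : ℝ) : ℂ)) atTop (𝓝 0) := by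
      have h := (Complex.continuous_ofReal.tendsto 0).comp
        (tendsto_one_div_add_atTop_nhds_zero_nat (𝕜 := ℝ))
      rwa [Complex.ofReal_zero] at h
    have hq : Tendsto q atTop (𝓝 z₀) := by
      have h := hq0.const_add z₀
      rwa [add_zero] at h
    have hqs : ∀ᶠ n in atTop, q n ∈ s := hq hs
    have hne : ∀ n, q n ≠ z₀ := fun n h => by
      have h1 : ((1 / ((n : ℝ) + 1) : ℝ) : ℂ) = 0 := by simpa [q] using h
      have h2 : (1 / ((n : ℝ) + 1) : ℝ) ≠ 0 := by positivity
      exact h2 (by exact_mod_cast h1)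
    obtain ⟨n₀, hn₀⟩ := eventually_atTop.1 hqs
    refine aestronglyMeasurable_of_tendsto_ae atTop
      (f := fun n u => deriv (Γ.arc j) u •
        slope (fun z => Φ z (Γ.arc j u)) z₀ (q (n + n₀))) (fun n => ?_) ?_
    · have h1 : ContinuousOn (fun w => slope (fun z => Φ z w) z₀ (q (n + n₀))) Γ.support := by
        simp only [slope, vsub_eq_sub]
        exact continuousOn_const.smul ((hcz _ (hn₀ _ (by omega))).sub
          (hcz z₀ (mem_of_mem_nhds hs)))
      exact (Γ.intervalIntegrable_arc j h1).def'.aestronglyMeasurable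
    · refine (ae_restrict_iff' measurableSet_uIoc).2 (ae_of_all _ fun u hu => ?_)
      refine Tendsto.const_smul ?_ _
      have h1 := (hasDerivAt_iff_tendsto_slope.1 (hda _ (hmem hu) z₀ hz₀))
      refine h1.comp (tendsto_nhdsWithin_iff.2 ⟨hq.comp (tendsto_add_atTop_nat n₀), ?_⟩)
      exact Eventually.of_forall fun n => hne _
  · refine ae_of_all _ fun u hu z hz => ?_
    rw [norm_smul]
    exact mul_le_mul_of_nonneg_left (hbd _ (hmem hu) z hz) (norm_nonneg _)
  · exact ((Γ.continuous_deriv_arc j).norm.mul continuous_const).intervalIntegrable _ _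
  · exact ae_of_all _ fun u hu z hz => (hda _ (hmem hu) z hz).const_smul _

/-! ### The homology form of Cauchy's theorem, after Dixon. -/

theorem dslope_comm (F : ℂ → E) (z w : ℂ) : dslope F z w = dslope F w z := by
  rcases eq_or_ne z w with rfl | h
  · rfl
  · rw [dslope_of_ne _ h.symm, dslope_of_ne _ h, slope_comm]

/-- The difference quotient of a holomorphic function is jointly continuous. -/
theorem continuousOn_dslope_uncurry [CompleteSpace E] {F : ℂ → E} {U : Set ℂ} (hU : IsOpen U)
    (hF : DifferentiableOn ℂ F U) :
    ContinuousOn (Function.uncurry (dslope F)) (U ×ˢ U) := by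
  rintro ⟨a, b⟩ ⟨ha : a ∈ U, hb : b ∈ U⟩
  have hcont : ∀ x ∈ U, ContinuousAt F x := fun x hx => (hF.differentiableAt
    (hU.mem_nhds hx)).continuousAt
  refine ContinuousAt.continuousWithinAt ?_
  rcases eq_or_ne a b with rfl | hab
  · have han : AnalyticAt ℂ F a := hF.analyticAt (hU.mem_nhds ha)
    have hs : HasStrictDerivAt F (deriv F a) a := han.hasStrictDerivAt
    rw [Metric.continuousAt_iff']
    intro ε hε
    -- On the diagonal, strict differentiability controls difference quotients with both points near
    -- `a`; the factor `1/2` leaves room for a strict inequality.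
    have h1 := (hs.hasStrictFDerivAt.isLittleO.def (half_pos hε))
    have h2 : ∀ᶠ z in 𝓝 a, dist (deriv F z) (deriv F a) < ε :=
      Metric.continuousAt_iff'.1 han.deriv.continuousAt ε hε
    have h3 : ∀ᶠ p : ℂ × ℂ in 𝓝 (a, a), dist (deriv F p.1) (deriv F a) < ε :=
      (continuous_fst.tendsto (a, a)).eventually h2
    filter_upwards [h1, h3] with p hp1 hp2
    obtain ⟨z, w⟩ := p
    simp only [Function.uncurry_apply_pair, dslope_same] at hp1 hp2 ⊢
    rcases eq_or_ne w z with rfl | hwz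
    · simpa using hp2
    · rw [dslope_of_ne _ hwz, dist_eq_norm, slope_comm]
      have h0 : z - w ≠ 0 := sub_ne_zero.2 hwz.symm
      have h4 : slope F w z - deriv F a = (z - w)⁻¹ • (F z - F w - (z - w) • deriv F a) := by
        rw [slope, smul_sub (z - w)⁻¹ (F z - F w), smul_smul, inv_mul_cancel₀ h0, one_smul,
          vsub_eq_sub]
      rw [h4, norm_smul, norm_inv, inv_mul_lt_iff₀ (norm_pos_iff.2 h0)]
      have h5 : 0 < ‖z - w‖ := norm_pos_iff.2 h0
      have h6 : ‖F z - F w - (z - w) • deriv F a‖ ≤ ε / 2 * ‖z - w‖ := by simpa using hp1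
      nlinarith
  · have hne : ∀ᶠ p : ℂ × ℂ in 𝓝 (a, b), p.2 ≠ p.1 :=
      (isOpen_ne_fun continuous_snd continuous_fst).mem_nhds hab.symm
    have hc : ContinuousAt (fun p : ℂ × ℂ => (p.2 - p.1)⁻¹ • (F p.2 - F p.1)) (a, b) := by
      refine ContinuousAt.smul (ContinuousAt.inv₀ (by fun_prop) (sub_ne_zero.2 hab.symm)) ?_
      exact (ContinuousAt.comp' (f := Prod.snd) (hcont b hb) continuousAt_snd).sub
        (ContinuousAt.comp' (f := Prod.fst) (hcont a ha) continuousAt_fst)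
    refine hc.congr (hne.mono fun p hp => ?_)
    rw [Function.uncurry, dslope_of_ne _ hp, slope, vsub_eq_sub]

/-- Two contours in an open set `U` that have the same index about every point outside `U` give
the same integral of every function holomorphic in `U`. -/
theorem integral_eq_of_index_eq [CompleteSpace E] {Γ Γ' : Contour} {U : Set ℂ} (hU : IsOpen U)
    (hΓ : Γ.support ⊆ U) (hΓ' : Γ'.support ⊆ U) (hidx : ∀ z ∉ U, Γ.index z = Γ'.index z)
    {F : ℂ → E} (hF : DifferentiableOn ℂ F U) : Γ.integral F = Γ'.integral F := by
  have key : ∀ G : ℂ → E, DifferentiableOn ℂ G U → ∀ z ∈ U,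
      Γ.integral (dslope G z) = Γ'.integral (dslope G z) := by
    classical
    intro G hG
    -- Dixon's function: `h₁` is defined on `U` and `h₂` off both contours. They agree where the
    -- indices agree, since then the terms containing `G z` cancel. The glued function is entire and
    -- vanishes at infinity, hence is zero by Liouville.
    let h₁ : ℂ → E := fun z => Γ.integral (dslope G z) - Γ'.integral (dslope G z)
    let h₂ : ℂ → E := fun z =>
      (Γ.integral fun w => (w - z)⁻¹ • G w) - Γ'.integral fun w => (w - z)⁻¹ • G w
    let h : ℂ → E := fun z => if z ∈ U then h₁ z else h₂ z
    have hcU : ∀ {S : Set ℂ}, S ⊆ U → ContinuousOn G S := fun hS => hG.continuousOn.mono hS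
    have hint : ∀ {Δ : Contour}, Δ.support ⊆ U → ∀ z ∈ U, z ∉ Δ.support →
        Δ.integral (dslope G z) =
          (Δ.integral fun w => (w - z)⁻¹ • G w) - (Δ.integral fun w => (w - z)⁻¹) • G z := by
      intro Δ hΔ z hz hzs
      rw [← integral_smul_const, ← integral_sub]
      · refine Δ.integral_congr fun w hw => ?_
        rw [dslope_of_ne _ (fun h : w = z => hzs (h ▸ hw)), slope, vsub_eq_sub, smul_sub]
      · exact (continuousOn_inv_sub hzs).smul (hcU hΔ)
      · exact (continuousOn_inv_sub hzs).smul continuousOn_const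
    have hpi : (2 * Real.pi * Complex.I : ℂ)⁻¹ ≠ 0 := by simp [Real.pi_ne_zero]
    have h12 : ∀ z, z ∉ Γ.support → z ∉ Γ'.support → Γ.index z = Γ'.index z → h z = h₂ z := by
      intro z hz hz' hi
      by_cases hzU : z ∈ U
      · simp only [h, if_pos hzU, h₁, h₂]
        rw [hint hΓ z hzU hz, hint hΓ' z hzU hz', mul_left_cancel₀ hpi hi]
        abel
      · simp only [h, if_neg hzU]
    have hd₁ : ∀ {Δ : Contour}, Δ.support ⊆ U → ∀ z ∈ U,
        DifferentiableAt ℂ (fun z => Δ.integral (dslope G z)) z := by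
      intro Δ hΔ z hz
      refine Δ.differentiableAt_integral (hU.mem_nhds hz)
        ((continuousOn_dslope_uncurry hU hG).mono (prod_mono le_rfl hΔ)) fun w hw => ?_
      simp only [fun z => dslope_comm G z w]
      exact (Complex.differentiableOn_dslope (hU.mem_nhds (hΔ hw))).2 hG
    have hd₂ : ∀ {Δ : Contour}, Δ.support ⊆ U → ∀ z ∉ Δ.support,
        DifferentiableAt ℂ (fun z => Δ.integral fun w => (w - z)⁻¹ • G w) z := by
      intro Δ hΔ z hz
      have hne : ∀ p ∈ Δ.supportᶜ ×ˢ Δ.support, p.2 - p.1 ≠ 0 := fun p hp =>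
        sub_ne_zero.2 fun h => hp.1 (h ▸ hp.2)
      refine Δ.differentiableAt_integral (s := Δ.supportᶜ) (Δ.eventually_notMem_support hz)
        ?_ fun w hw => ?_
      · refine ContinuousOn.smul (ContinuousOn.inv₀ (by fun_prop) hne) ?_
        exact (hcU hΔ).comp continuousOn_snd fun p hp => hp.2
      · exact (DifferentiableOn.inv (by fun_prop) fun z hz => hne (z, w) ⟨hz, hw⟩).smul_const _
    have hdiff : Differentiable ℂ h := by
      intro z
      by_cases hzU : z ∈ U
      · refine ((hd₁ hΓ z hzU).sub (hd₁ hΓ' z hzU)).congr_of_eventuallyEq ?_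
        filter_upwards [hU.mem_nhds hzU] with x hx
        simp only [h, if_pos hx]
        rfl
      · have hz : z ∉ Γ.support := fun h => hzU (hΓ h)
        have hz' : z ∉ Γ'.support := fun h => hzU (hΓ' h)
        refine ((hd₂ hΓ z hz).sub (hd₂ hΓ' z hz')).congr_of_eventuallyEq ?_
        filter_upwards [Γ.eventually_notMem_support hz, Γ'.eventually_notMem_support hz',
          Γ.eventually_index_eq hz, Γ'.eventually_index_eq hz'] with x h1 h2 h3 h4
        exact h12 x h1 h2 (by rw [h3, h4, hidx z hzU])
    have hlim : Tendsto h (cocompact ℂ) (𝓝 0) := by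
      have hl : ∀ {Δ : Contour}, Δ.support ⊆ U →
          Tendsto (fun z => Δ.integral fun w => (w - z)⁻¹ • G w) (cocompact ℂ) (𝓝 0) := by
        intro Δ hΔ
        obtain ⟨R, hR0, hR, -⟩ := Δ.exists_index_eq_zero
        obtain ⟨L, hL0, hL⟩ := Δ.exists_norm_integral_le (E := E)
        obtain ⟨M, hM⟩ := Δ.isCompact_support.exists_bound_of_continuousOn (hcU hΔ)
        have hn : Tendsto (fun z : ℂ => ‖z‖ - R) (cocompact ℂ) atTop :=
          tendsto_atTop_add_const_right _ _ (tendsto_norm_cocompact_atTop)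
        refine squeeze_zero_norm' (a := fun z : ℂ => L * ((‖z‖ - R)⁻¹ * |M|)) ?_ ?_
        · filter_upwards [hn.eventually_gt_atTop 0] with z hz
          refine hL _ _ fun w hw => ?_
          rw [norm_smul, norm_inv]
          refine mul_le_mul (inv_anti₀ hz ?_) ((hM w hw).trans (le_abs_self M))
            (norm_nonneg _) (inv_nonneg.2 hz.le)
          have := norm_sub_norm_le z w
          rw [norm_sub_rev] at this
          linarith [hR w hw]
        · simpa using ((tendsto_inv_atTop_zero.comp hn).mul_const |M|).const_mul L
      have h0 := (hl hΓ).sub (hl hΓ')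
      rw [sub_zero] at h0
      obtain ⟨R, -, hR, hRi⟩ := Γ.exists_index_eq_zero
      obtain ⟨R', -, hR', hRi'⟩ := Γ'.exists_index_eq_zero
      refine h0.congr' ?_
      filter_upwards [(tendsto_norm_cocompact_atTop (E := ℂ)).eventually_ge_atTop R,
        (tendsto_norm_cocompact_atTop (E := ℂ)).eventually_ge_atTop R'] with z hz hz'
      exact (h12 z (fun hm => (hR z hm).not_ge hz) (fun hm => (hR' z hm).not_ge hz')
        (by rw [hRi z hz, hRi' z hz'])).symm
    intro z hz
    have h0 : h z = 0 := hdiff.apply_eq_of_tendsto_cocompact z hlim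
    simp only [h, if_pos hz, h₁] at h0
    exact sub_eq_zero.1 h0
  rcases U.eq_empty_or_nonempty with rfl | ⟨z₀, hz₀⟩
  · rw [Γ.integral_congr (G := 0) fun w hw => absurd (hΓ hw) (by simp),
      Γ'.integral_congr (G := 0) fun w hw => absurd (hΓ' hw) (by simp)]
    simp [integral]
  -- Applied to `(w - z₀) F(w)`, whose difference quotient at `z₀` is `F` itself.
  · have h1 := key (fun w => (w - z₀) • F w) ((by fun_prop : DifferentiableOn ℂ (fun w : ℂ =>
      w - z₀) U).smul hF) z₀ hz₀
    have h2 : dslope (fun w => (w - z₀) • F w) z₀ = F := by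
      ext w
      rcases eq_or_ne w z₀ with rfl | hw
      · rw [dslope_same]
        have := (((hasDerivAt_id w).sub_const w).smul
          (hF.differentiableAt (hU.mem_nhds hz₀)).hasDerivAt).deriv
        exact this.trans (by simp)
      · exact dslope_sub_smul_of_ne _ hw
    rwa [h2] at h1

/-- The Cauchy integral that defines an analytic function of an operator does not depend on the
contour. -/
theorem Surrounds.integral_eq [CompleteSpace E] {Γ Γ' : Contour} {f : ℂ → ℂ} {K K' : Set ℂ}
    (hΓ : Γ.Surrounds f K) (hΓ' : Γ'.Surrounds f K) (hK : IsClosed K') (hKK : K' ⊆ K) {F : ℂ → E}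
    (hF : DifferentiableOn ℂ F K'ᶜ) :
    (Γ.integral fun z => f z • F z) = Γ'.integral fun z => f z • F z := by
  -- Outside this `U`, a point lies in `K'`, where both indices are `1`, or `f` fails to be analytic
  -- there, so that neither contour winds around it.
  refine integral_eq_of_index_eq (U := {z | AnalyticAt ℂ f z} ∩ K'ᶜ)
    ((isOpen_analyticAt ℂ f).inter hK.isOpen_compl)
    (fun z hz => ⟨hΓ.2.2 z (.inl hz), fun h => hΓ.1.le_bot ⟨hz, hKK h⟩⟩)
    (fun z hz => ⟨hΓ'.2.2 z (.inl hz), fun h => hΓ'.1.le_bot ⟨hz, hKK h⟩⟩) (fun z hz => ?_)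
    (DifferentiableOn.smul (fun z hz => hz.1.differentiableAt.differentiableWithinAt)
      (hF.mono inter_subset_right))
  by_cases hzK : z ∈ K'
  · rw [hΓ.2.1 z (hKK hzK), hΓ'.2.1 z (hKK hzK)]
  · have hna : ¬ AnalyticAt ℂ f z := fun h => hz ⟨h, hzK⟩
    rw [not_imp_comm.1 (fun h => hΓ.2.2 z (.inr h)) hna,
      not_imp_comm.1 (fun h => hΓ'.2.2 z (.inr h)) hna]

end Contour

/-! ### Contours made of circles. -/

namespace Contour

variable {E : Type*} [NormedAddCommGroup E] [NormedSpace ℂ E]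

/-- The contour that consists of finitely many counterclockwise circles. -/
def ofCircles {N : ℕ} (c : Fin N → ℂ) (R : Fin N → ℝ) : Contour where
  N := N
  arc j u := circleMap (c j) (R j) (2 * Real.pi * u)
  contDiff j := (contDiff_circleMap (c j) (R j)).comp (contDiff_const.mul contDiff_id)
  next := Equiv.refl _
  closed j := by simp [circleMap]

theorem integral_ofCircles {N : ℕ} (c : Fin N → ℂ) (R : Fin N → ℝ) (F : ℂ → E) :
    (ofCircles c R).integral F = ∑ j, ∮ z in C(c j, R j), F z := by
  refine Finset.sum_congr rfl fun j _ => ?_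
  have hd : ∀ u : ℝ, deriv (fun u : ℝ => circleMap (c j) (R j) (2 * Real.pi * u)) u =
      (2 * Real.pi : ℝ) • deriv (circleMap (c j) (R j)) (2 * Real.pi * u) := fun u => by
    have h1 : HasDerivAt (fun u : ℝ => 2 * Real.pi * u) (2 * Real.pi) u := by
      simpa using (hasDerivAt_id u).const_mul (2 * Real.pi)
    have h2 := (hasDerivAt_circleMap (c j) (R j) (2 * Real.pi * u)).scomp u h1
    rw [deriv_circleMap]
    exact h2.deriv
  change ∫ u in (0 : ℝ)..1, deriv (fun u : ℝ => circleMap (c j) (R j) (2 * Real.pi * u)) u •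
    F (circleMap (c j) (R j) (2 * Real.pi * u)) = _
  simp only [hd, smul_assoc]
  rw [intervalIntegral.integral_smul, intervalIntegral.smul_integral_comp_mul_left
    (fun θ => deriv (circleMap (c j) (R j)) θ • F (circleMap (c j) (R j) θ))]
  simp [circleIntegral]

theorem exists_mem_sphere_of_mem_support_ofCircles {N : ℕ} {c : Fin N → ℂ} {R : Fin N → ℝ}
    (hR : ∀ j, 0 ≤ R j) {z : ℂ} (hz : z ∈ (ofCircles c R).support) :
    ∃ j, z ∈ Metric.sphere (c j) (R j) := by
  obtain ⟨j, u, -, rfl⟩ := mem_iUnion.1 hz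
  exact ⟨j, circleMap_mem_sphere _ (hR j) _⟩

theorem circleIntegral_sub_inv_of_notMem {c z : ℂ} {R : ℝ} (hR : 0 ≤ R)
    (hz : z ∉ Metric.closedBall c R) : (∮ w in C(c, R), (w - z)⁻¹) = 0 := by
  have hne : ∀ w ∈ Metric.closedBall c R, w - z ≠ 0 := fun w hw =>
    sub_ne_zero.2 fun h => hz (h ▸ hw)
  refine Complex.circleIntegral_eq_zero_of_differentiable_on_off_countable hR countable_empty
    (ContinuousOn.inv₀ (by fun_prop) hne) fun w hw => ?_
  exact DifferentiableAt.inv (by fun_prop) (hne w (Metric.ball_subset_closedBall hw.1))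

/-- A union of circles around disjoint discs surrounds every subset of the union of the discs. -/
theorem surrounds_ofCircles {N : ℕ} {c : Fin N → ℂ} {R : Fin N → ℝ} (hR : ∀ j, 0 ≤ R j)
    (hdisj : Pairwise fun i j =>
      Disjoint (Metric.closedBall (c i) (R i)) (Metric.closedBall (c j) (R j)))
    {f : ℂ → ℂ} (hf : ∀ j, ∀ z ∈ Metric.closedBall (c j) (R j), AnalyticAt ℂ f z) {K : Set ℂ}
    (hK : K ⊆ ⋃ j, Metric.ball (c j) (R j)) : (ofCircles c R).Surrounds f K := by
  refine ⟨disjoint_left.2 fun z hz hzK => ?_, fun z hz => ?_, fun z hz => ?_⟩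
  · obtain ⟨i, hi⟩ := exists_mem_sphere_of_mem_support_ofCircles hR hz
    obtain ⟨j, hj⟩ := mem_iUnion.1 (hK hzK)
    rcases eq_or_ne i j with rfl | hij
    · exact (Metric.mem_ball.1 hj).ne (Metric.mem_sphere.1 hi)
    · exact (hdisj hij).le_bot
        ⟨Metric.sphere_subset_closedBall hi, Metric.ball_subset_closedBall hj⟩
  · obtain ⟨j, hj⟩ := mem_iUnion.1 (hK hz)
    rw [index, integral_ofCircles, Finset.sum_eq_single j (fun i _ hij => ?_) (by simp),
      circleIntegral.integral_sub_inv_of_mem_ball hj, inv_mul_cancel₀ Complex.two_pi_I_ne_zero]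
    exact circleIntegral_sub_inv_of_notMem (hR i) fun h =>
      (hdisj hij).le_bot ⟨h, Metric.ball_subset_closedBall hj⟩
  · rcases hz with hz | hz
    · obtain ⟨j, hj⟩ := exists_mem_sphere_of_mem_support_ofCircles hR hz
      exact hf j z (Metric.sphere_subset_closedBall hj)
    · by_contra hcon
      refine hz ?_
      rw [index, integral_ofCircles, Finset.sum_eq_zero fun j _ => ?_, mul_zero]
      exact circleIntegral_sub_inv_of_notMem (hR j) fun h => hcon (hf j z h)

end Contour

/-! ### Exponential Cauchy integrals over one circle. -/

/-- The integral `(2πi)⁻¹ ∮ e^{zt} F(z) dz` over the circle with centre `a` and radius `r`. -/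
def expCircle {E : Type*} [NormedAddCommGroup E] [NormedSpace ℂ E] (a : ℂ) (r : ℝ) (F : ℂ → E)
    (t : ℝ) : E :=
  (2 * Real.pi * Complex.I : ℂ)⁻¹ • ∮ z in C(a, r), Complex.exp (z * t) • F z

section expCircle

open Metric

variable {E : Type*} [NormedAddCommGroup E] [NormedSpace ℂ E] {a : ℂ} {r : ℝ} {F G : ℂ → E}

theorem circleIntegrable_exp_smul (hr : 0 ≤ r) (hF : ContinuousOn F (sphere a r)) (t : ℝ) :
    CircleIntegrable (fun z => Complex.exp (z * t) • F z) a r :=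
  ContinuousOn.circleIntegrable hr ((Continuous.continuousOn (by fun_prop)).smul hF)

theorem expCircle_congr (hr : 0 ≤ r) (h : ∀ z ∈ sphere a r, F z = G z) (t : ℝ) :
    expCircle a r F t = expCircle a r G t := by
  rw [expCircle, expCircle, circleIntegral.integral_congr hr fun z hz => ?_]
  simp only [h z hz]

theorem expCircle_add (hr : 0 ≤ r) (hF : ContinuousOn F (sphere a r))
    (hG : ContinuousOn G (sphere a r)) (t : ℝ) :
    expCircle a r (fun z => F z + G z) t = expCircle a r F t + expCircle a r G t := by
  simp only [expCircle, smul_add]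
  rw [circleIntegral.integral_add (circleIntegrable_exp_smul hr hF t)
    (circleIntegrable_exp_smul hr hG t), smul_add]

theorem expCircle_clm {E' : Type*} [NormedAddCommGroup E'] [NormedSpace ℂ E'] [CompleteSpace E]
    [CompleteSpace E'] (B : E →L[ℂ] E') (hr : 0 ≤ r) (hF : ContinuousOn F (sphere a r)) (t : ℝ) :
    expCircle a r (fun z => B (F z)) t = B (expCircle a r F t) := by
  simp only [expCircle, map_smul, circleIntegral]
  rw [← B.intervalIntegral_comp_comm]
  · simp only [map_smul]
  · exact (circleIntegrable_exp_smul hr hF t).out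

/-- The integral of an entire multiple of the exponential over a circle vanishes. -/
theorem expCircle_const (hr : 0 ≤ r) (x : E) (t : ℝ) : expCircle a r (fun _ => x) t = 0 := by
  rw [expCircle, Complex.circleIntegral_eq_zero_of_differentiable_on_off_countable hr
    countable_empty, smul_zero]
  · exact (by fun_prop : Continuous fun z : ℂ => Complex.exp (z * t) • x).continuousOn
  · intro z _
    fun_prop

theorem hasDerivAt_expCircle (hr : 0 ≤ r) (hF : ContinuousOn F (sphere a r)) (t : ℝ) :
    HasDerivAt (expCircle a r F) (expCircle a r (fun z => z • F z) t) t := by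
  refine HasDerivAt.const_smul (2 * Real.pi * Complex.I : ℂ)⁻¹ ?_
  have hF' : Continuous fun θ : ℝ => F (circleMap a r θ) :=
    hF.comp_continuous (continuous_circleMap a r) fun θ => circleMap_mem_sphere a hr θ
  have hc : Continuous (circleMap a r) := continuous_circleMap a r
  have hd : Continuous (deriv (circleMap a r)) := by
    rw [funext (deriv_circleMap a r)]
    exact (continuous_circleMap 0 r).mul continuous_const
  let Ψ : ℝ → ℝ → E := fun t θ => deriv (circleMap a r) θ •
    (Complex.exp (circleMap a r θ * t) • F (circleMap a r θ))
  let Ψ' : ℝ → ℝ → E := fun t θ => deriv (circleMap a r) θ •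
    (Complex.exp (circleMap a r θ * t) • circleMap a r θ • F (circleMap a r θ))
  have hc2 : Continuous fun p : ℝ × ℝ => circleMap a r p.2 := hc.comp continuous_snd
  have he : Continuous fun p : ℝ × ℝ => Complex.exp (circleMap a r p.2 * p.1) :=
    (hc2.mul (Complex.continuous_ofReal.comp continuous_fst)).cexp
  have hF2 : Continuous fun p : ℝ × ℝ => F (circleMap a r p.2) := hF'.comp continuous_snd
  have hΨ : Continuous (Function.uncurry Ψ) := by
    exact (hd.comp continuous_snd).smul (he.smul hF2)
  have hΨ' : Continuous (Function.uncurry Ψ') := by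
    exact (hd.comp continuous_snd).smul (he.smul (hc2.smul hF2))
  obtain ⟨M, hM⟩ := ((isCompact_closedBall t 1).prod
    (isCompact_Icc (a := 0) (b := 2 * Real.pi))).exists_bound_of_continuousOn hΨ'.continuousOn
  refine (intervalIntegral.hasDerivAt_integral_of_dominated_loc_of_deriv_le (F := Ψ) (F' := Ψ')
    (bound := fun _ => M) (ball_mem_nhds t one_pos) ?_ ?_ ?_ ?_ ?_ ?_).2
  · exact Eventually.of_forall fun x => (hΨ.uncurry_left x).aestronglyMeasurable
  · exact (hΨ.uncurry_left t).intervalIntegrable _ _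
  · exact (hΨ'.uncurry_left t).aestronglyMeasurable
  · refine ae_of_all _ fun θ hθ x hx => hM (x, θ) ⟨ball_subset_closedBall hx, ?_⟩
    rw [uIoc_of_le Real.two_pi_pos.le] at hθ
    exact Ioc_subset_Icc_self hθ
  · exact intervalIntegrable_const
  · refine ae_of_all _ fun θ _ x _ => ?_
    refine HasDerivAt.const_smul (deriv (circleMap a r) θ) ?_
    have h1 : HasDerivAt (fun x : ℝ => Complex.exp (circleMap a r θ * x))
        (Complex.exp (circleMap a r θ * x) * circleMap a r θ) x := by
      have := ((hasDerivAt_id (x : ℂ)).const_mul (circleMap a r θ)).cexp.comp_ofReal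
      simpa using this
    have := h1.smul_const (F (circleMap a r θ))
    rwa [mul_smul] at this

theorem continuous_expCircle (hr : 0 ≤ r) (hF : ContinuousOn F (sphere a r)) :
    Continuous (expCircle a r F) :=
  continuous_iff_continuousAt.2 fun t => (hasDerivAt_expCircle hr hF t).continuousAt

/-- Comparing real parts with `α` after multiplication by `t` treats both signs of `t` at once: it
is an upper bound on `Re z` for `t > 0` and a lower bound for `t < 0`. -/
theorem exists_norm_expCircle_le (hr : 0 ≤ r) (hF : ContinuousOn F (sphere a r)) :
    ∃ M : ℝ, 0 ≤ M ∧ ∀ t α : ℝ, (∀ z ∈ sphere a r, z.re * t ≤ α * t) →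
      ‖expCircle a r F t‖ ≤ M * Real.exp (α * t) := by
  obtain ⟨M, hM⟩ := (isCompact_sphere a r).exists_bound_of_continuousOn hF
  refine ⟨r * |M|, by positivity, fun t α h => ?_⟩
  rw [mul_assoc, mul_comm |M|]
  refine circleIntegral.norm_two_pi_i_inv_smul_integral_le_of_norm_le_const hr fun z hz => ?_
  rw [norm_smul, Complex.norm_exp]
  refine mul_le_mul (Real.exp_le_exp.2 ?_) ((hM z hz).trans (le_abs_self M)) (norm_nonneg _)
    (Real.exp_pos _).le
  simpa using h z hz

end expCircle

/-! ### Transforms over two discs separated by a vertical line. -/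

/-- Two discs that are separated by the vertical line `Re z = c` and cover `K`, such that on the
left disc `f_t` is `exp_{+,t}` and on the right disc it is `exp_{-,t}`, unless the disc in question
degenerates to a point. -/
structure ExpSplit (f : ℝ → ℂ → ℂ) (K : Set ℂ) where
  a : ℂ
  b : ℂ
  r : ℝ
  ρ : ℝ
  c : ℝ
  δ : ℝ
  r_nonneg : 0 ≤ r
  ρ_nonneg : 0 ≤ ρ
  δ_pos : 0 < δ
  re_le : ∀ z ∈ Metric.closedBall a r, z.re ≤ c - δ
  le_re : ∀ z ∈ Metric.closedBall b ρ, c + δ ≤ z.re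
  subset_union : K ⊆ Metric.ball a r ∪ Metric.ball b ρ
  analyticAt_left : ∀ t, ∀ z ∈ Metric.closedBall a r, AnalyticAt ℂ (f t) z
  analyticAt_right : ∀ t, ∀ z ∈ Metric.closedBall b ρ, AnalyticAt ℂ (f t) z
  eq_left : ∀ t, r ≠ 0 → ∀ z ∈ Metric.sphere a r, f t z = expPlus t z
  eq_right : ∀ t, ρ ≠ 0 → ∀ z ∈ Metric.sphere b ρ, f t z = expMinus t z

namespace ExpSplit

open Metric

variable {f : ℝ → ℂ → ℂ} {K : Set ℂ} (S : ExpSplit f K)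

theorem disjoint : Disjoint (closedBall S.a S.r) (closedBall S.b S.ρ) :=
  disjoint_left.2 fun z h h' => by
    have := S.re_le z h
    have := S.le_re z h'
    have := S.δ_pos
    linarith

theorem sphere_left_subset : sphere S.a S.r ⊆ Kᶜ := fun z hz hK => by
  rcases S.subset_union hK with h | h
  · exact (mem_ball.1 h).ne (mem_sphere.1 hz)
  · exact S.disjoint.le_bot ⟨sphere_subset_closedBall hz, ball_subset_closedBall h⟩

theorem sphere_right_subset : sphere S.b S.ρ ⊆ Kᶜ := fun z hz hK => by
  rcases S.subset_union hK with h | h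
  · exact S.disjoint.le_bot ⟨ball_subset_closedBall h, sphere_subset_closedBall hz⟩
  · exact (mem_ball.1 h).ne (mem_sphere.1 hz)

/-- The contour that consists of the boundaries of both discs. -/
def contour : Contour := Contour.ofCircles ![S.a, S.b] ![S.r, S.ρ]

theorem surrounds_contour {g : ℂ → ℂ} (hl : ∀ z ∈ closedBall S.a S.r, AnalyticAt ℂ g z)
    (hr : ∀ z ∈ closedBall S.b S.ρ, AnalyticAt ℂ g z) : S.contour.Surrounds g K := by
  refine Contour.surrounds_ofCircles ?_ ?_ ?_ ?_
  · simp [Fin.forall_fin_two, S.r_nonneg, S.ρ_nonneg]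
  · intro i j hij
    fin_cases i <;> fin_cases j
    · exact absurd rfl hij
    · exact S.disjoint
    · exact S.disjoint.symm
    · exact absurd rfl hij
  · rw [Fin.forall_fin_two]
    exact ⟨hl, hr⟩
  · refine S.subset_union.trans (union_subset ?_ ?_)
    · exact subset_iUnion (fun j =>
        ball ((![S.a, S.b] : Fin 2 → ℂ) j) ((![S.r, S.ρ] : Fin 2 → ℝ) j)) 0
    · exact subset_iUnion (fun j =>
        ball ((![S.a, S.b] : Fin 2 → ℂ) j) ((![S.r, S.ρ] : Fin 2 → ℝ) j)) 1

theorem surrounds (t : ℝ) : S.contour.Surrounds (f t) K :=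
  S.surrounds_contour (S.analyticAt_left t) (S.analyticAt_right t)

variable {E : Type*} [NormedAddCommGroup E] [NormedSpace ℂ E]

/-- The Cauchy integral of `f_t F` over the boundaries of both discs. -/
def eval (F : ℂ → E) (t : ℝ) : E :=
  if 0 < t then expCircle S.a S.r F t else if t < 0 then -expCircle S.b S.ρ F t else 0

theorem eval_of_pos (F : ℂ → E) {t : ℝ} (ht : 0 < t) : S.eval F t = expCircle S.a S.r F t :=
  if_pos ht

theorem eval_of_neg (F : ℂ → E) {t : ℝ} (ht : t < 0) : S.eval F t = -expCircle S.b S.ρ F t := by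
  rw [eval, if_neg ht.not_gt, if_pos ht]

/-- For each `t ≠ 0` one of `exp_{±,t}` is zero, so one circle drops out; at `t = 0` both do, which
matches the default in `eval`. A degenerate disc contributes nothing whatever `f t` is at its
centre. -/
theorem smul_integral_contour (F : ℂ → E) (t : ℝ) :
    (2 * Real.pi * Complex.I : ℂ)⁻¹ • (S.contour.integral fun z => f t z • F z) = S.eval F t := by
  have hl : (∮ z in C(S.a, S.r), f t z • F z) = ∮ z in C(S.a, S.r), expPlus t z • F z := by
    rcases eq_or_ne S.r 0 with h | h
    · simp [h]
    · exact circleIntegral.integral_congr S.r_nonneg fun z hz => by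
        simp only [S.eq_left t h z hz]
  have hr : (∮ z in C(S.b, S.ρ), f t z • F z) = ∮ z in C(S.b, S.ρ), expMinus t z • F z := by
    rcases eq_or_ne S.ρ 0 with h | h
    · simp [h]
    · exact circleIntegral.integral_congr S.ρ_nonneg fun z hz => by
        simp only [S.eq_right t h z hz]
  rw [contour, Contour.integral_ofCircles, Fin.sum_univ_two]
  simp only [Matrix.cons_val_zero, Matrix.cons_val_one]
  rw [hl, hr]
  have h0 : ∀ a r, (∮ z in C(a, r), (0 : ℂ) • F z) = 0 := fun a r => by
    simp [circleIntegral]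
  rcases lt_trichotomy t 0 with ht | rfl | ht
  · simp only [expPlus, expMinus, if_neg ht.not_gt, if_pos ht, h0, S.eval_of_neg F ht, expCircle,
      neg_smul, zero_add]
    rw [← smul_neg]
    simp [circleIntegral]
  · simp only [expPlus, expMinus, lt_irrefl, if_false, h0, eval, add_zero, smul_zero]
  · simp only [expPlus, expMinus, if_pos ht, if_neg ht.not_gt, h0, S.eval_of_pos F ht, expCircle,
      add_zero]

theorem eval_of_surrounds [CompleteSpace E] {K' : Set ℂ} (hK : IsClosed K') (hKK : K' ⊆ K)
    {F : ℂ → E} (hF : DifferentiableOn ℂ F K'ᶜ) {t : ℝ} {Γ : Contour} (hΓ : Γ.Surrounds (f t) K) :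
    (2 * Real.pi * Complex.I : ℂ)⁻¹ • (Γ.integral fun z => f t z • F z) = S.eval F t := by
  rw [hΓ.integral_eq (S.surrounds t) hK hKK hF, S.smul_integral_contour]

/-- The same discs, for a subset of `K`. -/
def mono {K' : Set ℂ} (h : K' ⊆ K) : ExpSplit f K' :=
  { S with subset_union := h.trans S.subset_union }

/-- Contour independence replaces the chosen contour in `opFun` by one pair of discs. The larger set
`K` lets the same discs serve all diagonal blocks. -/
theorem opFun_eq {V : Type*} [NormedAddCommGroup V] [NormedSpace ℂ V] [CompleteSpace V]
    {T : V →L[ℂ] V} (hT : spectrum ℂ T ⊆ K) (t : ℝ) :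
    opFun (f t) T = S.eval (resolvent T) t := by
  have h : ∃ Γ : Contour, Γ.Surrounds (f t) (spectrum ℂ T) := ⟨_, (S.mono hT).surrounds t⟩
  rw [opFun, dif_pos h]
  refine (S.mono hT).eval_of_surrounds (spectrum.isClosed T) le_rfl (fun z hz => ?_) h.choose_spec
  exact (spectrum.hasDerivAt_resolvent_const_left
    (not_not.1 hz)).differentiableAt.differentiableWithinAt

theorem stronglyMeasurable_eval {F : ℂ → E} (hF : ContinuousOn F Kᶜ) :
    StronglyMeasurable (S.eval F) :=
  StronglyMeasurable.ite measurableSet_Ioi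
    (continuous_expCircle S.r_nonneg (hF.mono S.sphere_left_subset)).stronglyMeasurable
    (StronglyMeasurable.ite measurableSet_Iio
      (continuous_expCircle S.ρ_nonneg (hF.mono S.sphere_right_subset)).neg.stronglyMeasurable
      stronglyMeasurable_const)

/-- For `t > 0` the left disc gives `e^{(c-δ)t}`, for `t < 0` the right one gives `e^{(c+δ)t}`; both
equal `e^{ct-δ|t|}`. -/
theorem exists_norm_eval_le {F : ℂ → E} (hF : ContinuousOn F Kᶜ) :
    ∃ M : ℝ, 0 ≤ M ∧ ∀ t, ‖S.eval F t‖ ≤ M * Real.exp (S.c * t - S.δ * |t|) := by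
  obtain ⟨M, hM0, hM⟩ := exists_norm_expCircle_le S.r_nonneg (hF.mono S.sphere_left_subset)
  obtain ⟨M', hM0', hM'⟩ := exists_norm_expCircle_le S.ρ_nonneg (hF.mono S.sphere_right_subset)
  refine ⟨max M M', le_max_of_le_left hM0, fun t => ?_⟩
  rcases lt_trichotomy t 0 with ht | rfl | ht
  · rw [S.eval_of_neg F ht, norm_neg, abs_of_neg ht]
    refine (hM' t (S.c + S.δ) fun z hz => ?_).trans ?_
    · exact mul_le_mul_of_nonpos_right (S.le_re z (sphere_subset_closedBall hz)) ht.le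
    · rw [show (S.c + S.δ) * t = S.c * t - S.δ * -t by ring]
      exact mul_le_mul_of_nonneg_right (le_max_right _ _) (Real.exp_pos _).le
  · simp only [eval, lt_irrefl, if_false, norm_zero]
    positivity
  · rw [S.eval_of_pos F ht, abs_of_pos ht]
    refine (hM t (S.c - S.δ) fun z hz => ?_).trans ?_
    · exact mul_le_mul_of_nonneg_right (S.re_le z (sphere_subset_closedBall hz)) ht.le
    · rw [show (S.c - S.δ) * t = S.c * t - S.δ * t by ring]
      exact mul_le_mul_of_nonneg_right (le_max_left _ _) (Real.exp_pos _).le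

/-- The jump of `eval F` at `0` is the residue of `F` at infinity. -/
theorem expCircle_zero_add [CompleteSpace E] (hK : IsClosed K) {F : ℂ → E}
    (hF : DifferentiableOn ℂ F Kᶜ) {L : E}
    (hL : Tendsto (fun z => z • F z) (Bornology.cobounded ℂ) (𝓝 L)) :
    expCircle S.a S.r F 0 + expCircle S.b S.ρ F 0 = L := by
  have hone : ∀ z : ℂ, AnalyticAt ℂ (fun _ => (1 : ℂ)) z := fun z => analyticAt_const
  have hS := S.surrounds_contour (fun z _ => hone z) fun z _ => hone z
  have hb : Bornology.IsBounded K := (isBounded_ball.union isBounded_ball).subset S.subset_union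
  obtain ⟨R₀, hR₀⟩ := hb.subset_ball 0
  -- At `t = 0` the exponential is `1`, so the two circles may be replaced by one large circle;
  -- there `F` is `L / z` up to an error `ε / R`.
  have hbig : ∀ R, 0 < R → R₀ ≤ R → expCircle S.a S.r F 0 + expCircle S.b S.ρ F 0 =
      (2 * Real.pi * Complex.I : ℂ)⁻¹ • ∮ z in C(0, R), F z := by
    intro R hR hRR
    have h1 : (Contour.ofCircles ![(0 : ℂ)] ![R]).Surrounds (fun _ => 1) K := by
      refine Contour.surrounds_ofCircles (by simp [hR.le]) ?_ (fun _ z _ => hone z) ?_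
      · intro i j hij
        exact absurd (Subsingleton.elim i j) hij
      · exact (hR₀.trans (ball_subset_ball hRR)).trans
          (subset_iUnion (fun j => ball ((![0] : Fin 1 → ℂ) j) ((![R] : Fin 1 → ℝ) j)) 0)
    have h2 := hS.integral_eq h1 hK le_rfl hF
    rw [contour, Contour.integral_ofCircles, Contour.integral_ofCircles, Fin.sum_univ_two,
      Fin.sum_univ_one] at h2
    simp only [Matrix.cons_val_zero, Matrix.cons_val_one, one_smul] at h2
    rw [← h2, smul_add]
    simp [expCircle]
  refine eq_of_forall_dist_le fun ε hε => ?_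
  have hev := (Metric.tendsto_nhds.1 hL) ε hε
  obtain ⟨R₁, -, hR₁⟩ := (hasBasis_cobounded_norm (E := ℂ)).eventually_iff.1 hev
  set R := max (max R₀ R₁) 1
  have hR : 0 < R := lt_max_of_lt_right one_pos
  have hR0 : R₀ ≤ R := (le_max_left _ _).trans (le_max_left _ _)
  rw [hbig R hR hR0]
  have hsph : sphere (0 : ℂ) R ⊆ Kᶜ := fun z hz hzK =>
    ((mem_ball.1 (hR₀ hzK)).trans_le hR0).ne (mem_sphere.1 hz)
  have hne : ∀ z ∈ sphere (0 : ℂ) R, z ≠ 0 := fun z hz => ne_of_mem_sphere hz hR.ne'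
  have hL' : (2 * Real.pi * Complex.I : ℂ)⁻¹ • (∮ z in C(0, R), (z - 0)⁻¹ • L) = L := by
    rw [circleIntegral.integral_smul_const, circleIntegral.integral_sub_center_inv _ hR.ne',
      smul_smul, inv_mul_cancel₀ Complex.two_pi_I_ne_zero, one_smul]
  rw [dist_eq_norm]
  rw [← hL']
  rw [← smul_sub, ← circleIntegral.integral_sub]
  · have h3 := circleIntegral.norm_two_pi_i_inv_smul_integral_le_of_norm_le_const (E := E) hR.le
      (c := 0) (C := R⁻¹ * ε) (f := fun z => F z - (z - 0)⁻¹ • L) fun z hz => by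
        have h4 : F z - (z - 0)⁻¹ • L = z⁻¹ • (z • F z - L) := by
          rw [smul_sub, smul_smul, inv_mul_cancel₀ (hne z hz), one_smul, sub_zero]
        have hnz : ‖z‖ = R := by simpa using hz
        rw [h4, norm_smul, norm_inv, hnz, ← dist_eq_norm]
        refine mul_le_mul_of_nonneg_left (hR₁ ?_).le (by positivity)
        change R₁ ≤ ‖z‖
        rw [hnz]
        exact (le_max_right _ _).trans (le_max_left _ _)
    rwa [mul_inv_cancel_left₀ hR.ne'] at h3
  · exact ContinuousOn.circleIntegrable hR.le (hF.continuousOn.mono hsph)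
  · refine ContinuousOn.circleIntegrable hR.le (ContinuousOn.smul (ContinuousOn.inv₀
      (by fun_prop) fun z hz => ?_) continuousOn_const)
    simpa using hne z hz

end ExpSplit

theorem integrable_exp_neg_mul_abs {δ : ℝ} (hδ : 0 < δ) :
    Integrable fun s : ℝ => Real.exp (-δ * |s|) := by
  have h1 : IntegrableOn (fun s : ℝ => Real.exp (-δ * |s|)) (Ioi 0) :=
    (exp_neg_integrableOn_Ioi 0 hδ).congr_fun (fun s hs => by
      simp only [abs_of_pos (show (0 : ℝ) < s from hs)]) measurableSet_Ioi
  have h2 : IntegrableOn (fun s : ℝ => Real.exp (-δ * |s|)) (Iic 0) := by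
    rw [integrableOn_Iic_iff_integrableOn_Iio]
    have := (h1.integrable_indicator measurableSet_Ioi).comp_neg
    refine (integrable_indicator_iff measurableSet_Iio).1 (this.congr (ae_of_all _ fun s => ?_))
    simp [indicator]
  rw [← integrableOn_univ, ← Iic_union_Ioi (a := (0 : ℝ))]
  exact h2.union h1

/-- The resolvent is `1/z` to first order at infinity. -/
theorem tendsto_smul_resolvent {V : Type*} [NormedAddCommGroup V] [NormedSpace ℂ V]
    [CompleteSpace V] (T : V →L[ℂ] V) :
    Tendsto (fun z : ℂ => z • resolvent T z) (Bornology.cobounded ℂ) (𝓝 1) := by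
  have h0 := spectrum.resolvent_tendsto_cobounded (𝕜 := ℂ) T
  have h1 : Tendsto (fun z : ℂ => T * resolvent T z + 1) (Bornology.cobounded ℂ) (𝓝 1) := by
    simpa using (h0.const_mul T).add_const 1
  refine h1.congr' ?_
  filter_upwards [Bornology.isBounded_def.1 (spectrum.isBounded (𝕜 := ℂ) T)] with z hz
  have h2 : (algebraMap ℂ (V →L[ℂ] V) z - T) * resolvent T z = 1 :=
    Ring.mul_inverse_cancel _ (not_not.1 hz)
  rw [sub_mul, sub_eq_iff_eq_add, Algebra.algebraMap_eq_smul_one, smul_mul_assoc, one_mul] at h2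
  rw [h2, add_comm]

/-! ### The convolution theorem. -/

namespace ExpSplit

open Metric

variable {f : ℝ → ℂ → ℂ} {K : Set ℂ} (S : ExpSplit f K)
  {V W Z : Type*} [NormedAddCommGroup V] [NormedSpace ℂ V] [NormedAddCommGroup W]
  [NormedSpace ℂ W] [NormedAddCommGroup Z] [NormedSpace ℂ Z]

theorem differentiableOn_resolvent [CompleteSpace W] {T : W →L[ℂ] W} (hT : spectrum ℂ T ⊆ K) :
    DifferentiableOn ℂ (resolvent T) Kᶜ := fun _ hz =>
  (spectrum.hasDerivAt_resolvent_const_left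
    (not_not.1 fun h => hz (hT h))).differentiableAt.differentiableWithinAt

theorem resolvent_mul {T : W →L[ℂ] W} {z : ℂ} (hz : z ∉ spectrum ℂ T) :
    z • resolvent T z = resolvent T z ∘L T + 1 := by
  have h2 : resolvent T z * (algebraMap ℂ (W →L[ℂ] W) z - T) = 1 :=
    Ring.inverse_mul_cancel _ (not_not.1 hz)
  rw [mul_sub, sub_eq_iff_eq_add, Algebra.algebraMap_eq_smul_one, mul_smul_comm, mul_one] at h2
  rw [h2, add_comm]
  rfl

theorem mul_resolvent {T : W →L[ℂ] W} {z : ℂ} (hz : z ∉ spectrum ℂ T) :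
    z • resolvent T z = T ∘L resolvent T z + 1 := by
  have h2 : (algebraMap ℂ (W →L[ℂ] W) z - T) * resolvent T z = 1 :=
    Ring.mul_inverse_cancel _ (not_not.1 hz)
  rw [sub_mul, sub_eq_iff_eq_add, Algebra.algebraMap_eq_smul_one, smul_mul_assoc, one_mul] at h2
  rw [h2, add_comm]
  rfl

theorem hasDerivAt_comp {u : ℝ → W →L[ℂ] Z} {v : ℝ → V →L[ℂ] W} {u' : W →L[ℂ] Z}
    {v' : V →L[ℂ] W} {s : ℝ} (hu : HasDerivAt u u' s) (hv : HasDerivAt v v' s) :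
    HasDerivAt (fun s => u s ∘L v s) (u s ∘L v' + u' ∘L v s) s :=
  ContinuousLinearMap.hasDerivAt_of_bilinear
    (B := (ContinuousLinearMap.compL ℂ V W Z).bilinearRestrictScalars ℝ) (fun _ => hu) fun _ => hv

/-- The derivative of the product of a Cauchy integral of `C B (z - T)⁻¹` and the reflected
exponential of `T`. -/
theorem hasDerivAt_expCircle_comp [CompleteSpace V] [CompleteSpace W] [CompleteSpace Z]
    {T : W →L[ℂ] W} (hT : spectrum ℂ T ⊆ K) (B : W →L[ℂ] V)
    {C : ℂ → V →L[ℂ] Z} (hC : ContinuousOn C Kᶜ) {a b : ℂ} {r ρ : ℝ} (hr : 0 ≤ r) (hρ : 0 ≤ ρ)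
    (ha : sphere a r ⊆ Kᶜ) (hb : sphere b ρ ⊆ Kᶜ) (t s : ℝ) :
    HasDerivAt (fun s => expCircle a r (fun z => C z ∘L B ∘L resolvent T z) s ∘L
        expCircle b ρ (resolvent T) (t - s))
      (expCircle a r C s ∘L B ∘L expCircle b ρ (resolvent T) (t - s)) s := by
  have hR : ContinuousOn (resolvent T) Kᶜ := (differentiableOn_resolvent hT).continuousOn
  have hΦ : ContinuousOn (fun z => C z ∘L B ∘L resolvent T z) Kᶜ :=
    hC.clm_comp (continuousOn_const.clm_comp hR)
  have h1 := hasDerivAt_expCircle hr (hΦ.mono ha) s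
  have h2 := hasDerivAt_expCircle hρ (hR.mono hb) (t - s)
  have h3 : HasDerivAt (fun s => expCircle b ρ (resolvent T) (t - s))
      (-(expCircle b ρ (fun z => z • resolvent T z) (t - s))) s := by
    have := h2.scomp s ((hasDerivAt_id s).const_sub t)
    exact this.congr_deriv (by simp)
  refine (hasDerivAt_comp h1 h3).congr_deriv ?_
  -- This is `zΦ = ΦT + CB`, integrated. The term `ΦT` cancels against the derivative of the second
  -- factor.
  have e1 : expCircle a r (fun z => z • C z ∘L B ∘L resolvent T z) s =
      expCircle a r (fun z => C z ∘L B ∘L resolvent T z) s ∘L T + expCircle a r C s ∘L B := by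
    have hsph : ∀ z ∈ sphere a r, z • C z ∘L B ∘L resolvent T z =
        (ContinuousLinearMap.compL ℂ W W Z).flip T (C z ∘L B ∘L resolvent T z) +
          (ContinuousLinearMap.compL ℂ W V Z).flip B (C z) := fun z hz => by
      have h := resolvent_mul fun h => ha hz (hT h)
      ext x
      have hx := DFunLike.congr_fun h x
      simp only [smul_apply, add_apply, ContinuousLinearMap.comp_apply, one_apply_eq_self,
        ContinuousLinearMap.flip_apply, ContinuousLinearMap.compL_apply] at hx ⊢
      rw [← map_add, ← map_add, ← hx, map_smul, map_smul]
    have hc1 : ContinuousOn (fun z => (ContinuousLinearMap.compL ℂ W W Z).flip T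
        (C z ∘L B ∘L resolvent T z)) (sphere a r) :=
      ((ContinuousLinearMap.compL ℂ W W Z).flip T).continuous.comp_continuousOn
      (hΦ.mono ha)
    have hc2 : ContinuousOn (fun z => (ContinuousLinearMap.compL ℂ W V Z).flip B (C z))
        (sphere a r) := ((ContinuousLinearMap.compL ℂ W V Z).flip B).continuous.comp_continuousOn
      (hC.mono ha)
    rw [expCircle_congr hr hsph, expCircle_add hr hc1 hc2,
      expCircle_clm ((ContinuousLinearMap.compL ℂ W W Z).flip T) hr (hΦ.mono ha),
      expCircle_clm ((ContinuousLinearMap.compL ℂ W V Z).flip B) hr (hC.mono ha)]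
    rfl
  -- In `zR = TR + 1` the constant contributes an entire integrand, whose integral over the circle
  -- vanishes.
  have e2 : expCircle b ρ (fun z => z • resolvent T z) (t - s) =
      T ∘L expCircle b ρ (resolvent T) (t - s) := by
    have hsph : ∀ z ∈ sphere b ρ, z • resolvent T z =
        ContinuousLinearMap.compL ℂ W W W T (resolvent T z) + 1 := fun z hz =>
      mul_resolvent fun h => hb hz (hT h)
    have hc1 : ContinuousOn (fun z => ContinuousLinearMap.compL ℂ W W W T (resolvent T z))
        (sphere b ρ) :=
      (ContinuousLinearMap.compL ℂ W W W T).continuous.comp_continuousOn (hR.mono hb)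
    rw [expCircle_congr hρ hsph, expCircle_add hρ hc1 continuousOn_const, expCircle_const hρ,
      expCircle_clm (ContinuousLinearMap.compL ℂ W W W T) hρ (hR.mono hb), add_zero]
    rfl
  rw [e1, e2]
  ext x
  simp

/-- The exponents `cs` and `c(t - s)` add up to the constant `ct`, so the position of the separating
line does not affect integrability; the decay of the first factor suffices. -/
theorem exists_norm_eval_mul_le [CompleteSpace W] {E : Type*} [NormedAddCommGroup E]
    [NormedSpace ℂ E] {T : W →L[ℂ] W} (hT : spectrum ℂ T ⊆ K) {H : ℂ → E}
    (hH : ContinuousOn H Kᶜ) (t : ℝ) : ∃ M : ℝ, ∀ s,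
      ‖S.eval H s‖ * ‖S.eval (resolvent T) (t - s)‖ ≤ M * Real.exp (-S.δ * |s|) := by
  obtain ⟨M, hM0, hM⟩ := S.exists_norm_eval_le hH
  obtain ⟨M', hM0', hM'⟩ := S.exists_norm_eval_le (differentiableOn_resolvent hT).continuousOn
  refine ⟨M * M' * Real.exp (S.c * t), fun s => ?_⟩
  refine (mul_le_mul (hM s) (hM' (t - s)) (norm_nonneg _) (by positivity)).trans ?_
  rw [mul_mul_mul_comm, ← Real.exp_add, mul_assoc (M * M'), ← Real.exp_add]
  refine mul_le_mul_of_nonneg_left (Real.exp_le_exp.2 ?_) (by positivity)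
  have := mul_nonneg S.δ_pos.le (abs_nonneg (t - s))
  linarith

theorem stronglyMeasurable_clm_comp {α : Type*} [MeasurableSpace α] {u : α → W →L[ℂ] Z}
    {v : α → V →L[ℂ] W} (hu : StronglyMeasurable u) (hv : StronglyMeasurable v) :
    StronglyMeasurable fun s => u s ∘L v s :=
  (continuous_fst.clm_comp continuous_snd).comp_stronglyMeasurable (hu.prodMk hv)

theorem integrable_eval_comp [CompleteSpace W] {T : W →L[ℂ] W} (hT : spectrum ℂ T ⊆ K)
    (B : W →L[ℂ] V) {C : ℂ → V →L[ℂ] Z} (hC : ContinuousOn C Kᶜ) (t : ℝ) :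
    Integrable fun s => S.eval C s ∘L B ∘L S.eval (resolvent T) (t - s) := by
  obtain ⟨M, hM⟩ := S.exists_norm_eval_mul_le hT hC t
  refine Integrable.mono' ((integrable_exp_neg_mul_abs S.δ_pos).const_mul (‖B‖ * M))
    (stronglyMeasurable_clm_comp (S.stronglyMeasurable_eval hC)
      (stronglyMeasurable_clm_comp stronglyMeasurable_const
        ((S.stronglyMeasurable_eval (differentiableOn_resolvent hT).continuousOn).comp_measurable
          (measurable_const.sub measurable_id)))).aestronglyMeasurable (ae_of_all _ fun s => ?_)
  calc ‖S.eval C s ∘L B ∘L S.eval (resolvent T) (t - s)‖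
      ≤ ‖S.eval C s‖ * (‖B‖ * ‖S.eval (resolvent T) (t - s)‖) :=
        (ContinuousLinearMap.opNorm_comp_le _ _).trans
          (mul_le_mul_of_nonneg_left (ContinuousLinearMap.opNorm_comp_le _ _) (norm_nonneg _))
    _ = ‖B‖ * (‖S.eval C s‖ * ‖S.eval (resolvent T) (t - s)‖) := by ring
    _ ≤ ‖B‖ * (M * Real.exp (-S.δ * |s|)) := mul_le_mul_of_nonneg_left (hM s) (norm_nonneg _)
    _ = _ := by ring

/-- The fundamental theorem of calculus on the line for a function that is given piecewise on three
intervals. -/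
theorem integral_eq_of_piecewise_hasDerivAt {E : Type*} [NormedAddCommGroup E] [NormedSpace ℝ E]
    [CompleteSpace E] {α β : ℝ} (hαβ : α ≤ β) {j u v w : ℝ → E} (hj : Integrable j)
    (hu : Continuous u) (hv : Continuous v) (hw : Continuous w)
    (hu' : ∀ s < α, HasDerivAt u (j s) s) (hv' : ∀ s ∈ Ioo α β, HasDerivAt v (j s) s)
    (hw' : ∀ s, β < s → HasDerivAt w (j s) s) (hu0 : Tendsto u atBot (𝓝 0))
    (hw0 : Tendsto w atTop (𝓝 0)) : ∫ s, j s = u α + (v β - v α) - w β := by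
  rw [← intervalIntegral.integral_Iic_add_Ioi (b := α) hj.integrableOn hj.integrableOn,
    ← intervalIntegral.integral_interval_add_Ioi (a := α) (b := β) hj.integrableOn hj.integrableOn,
    integral_Iic_of_hasDerivAt_of_tendsto hu.continuousWithinAt hu' hj.integrableOn hu0,
    intervalIntegral.integral_eq_sub_of_hasDerivAt_of_le hαβ hv.continuousOn hv'
      hj.intervalIntegrable,
    integral_Ioi_of_hasDerivAt_of_tendsto hw.continuousWithinAt hw' hj.integrableOn hw0]
  abel

theorem eval_comp_eq_integral [CompleteSpace V] [CompleteSpace W] [CompleteSpace Z]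
    (hK : IsClosed K) {T : W →L[ℂ] W} (hT : spectrum ℂ T ⊆ K)
    (B : W →L[ℂ] V) {C : ℂ → V →L[ℂ] Z} (hC : DifferentiableOn ℂ C Kᶜ)
    (hC0 : Tendsto C (Bornology.cobounded ℂ) (𝓝 0)) {t : ℝ} (ht : t ≠ 0) :
    ∫ s, S.eval C s ∘L B ∘L S.eval (resolvent T) (t - s) =
      S.eval (fun z => C z ∘L B ∘L resolvent T z) t := by
  have hR : DifferentiableOn ℂ (resolvent T) Kᶜ := differentiableOn_resolvent hT
  set Φ : ℂ → W →L[ℂ] Z := fun z => C z ∘L B ∘L resolvent T z with hΦ_def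
  have hΦ : DifferentiableOn ℂ Φ Kᶜ := hC.clm_comp ((differentiableOn_const B).clm_comp hR)
  have hj := S.integrable_eval_comp hT B hC.continuousOn t
  have hjumpR := S.expCircle_zero_add hK hR (tendsto_smul_resolvent T)
  have hjumpΦ : expCircle S.a S.r Φ 0 + expCircle S.b S.ρ Φ 0 = 0 := by
    refine S.expCircle_zero_add hK hΦ ?_
    -- `zΦ = C B (zR)` tends to `0 · B · 1`: the product has no residue at infinity, hence no jump
    -- at `0`.
    have h1 : Tendsto (fun z => C z ∘L B ∘L (z • resolvent T z)) (Bornology.cobounded ℂ)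
        (𝓝 ((0 : V →L[ℂ] Z) ∘L B ∘L (1 : W →L[ℂ] W))) :=
      ((continuous_fst.clm_comp (continuous_const.clm_comp continuous_snd)).tendsto
        ((0 : V →L[ℂ] Z), (1 : W →L[ℂ] W))).comp
          (hC0.prodMk_nhds (tendsto_smul_resolvent T))
    rw [ContinuousLinearMap.zero_comp] at h1
    refine h1.congr fun z => ?_
    ext x
    simp [Φ]
  obtain ⟨M, hM⟩ := S.exists_norm_eval_mul_le hT hΦ.continuousOn t
  have hJ : ∀ {l : Filter ℝ}, Tendsto (fun s : ℝ => |s|) l atTop →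
      Tendsto (fun s => S.eval Φ s ∘L S.eval (resolvent T) (t - s)) l (𝓝 0) := by
    intro l hl
    refine squeeze_zero_norm (a := fun s => M * Real.exp (-S.δ * |s|)) (fun s =>
      (ContinuousLinearMap.opNorm_comp_le _ _).trans (hM s)) ?_
    have := (Real.tendsto_exp_atBot.comp
      (hl.const_mul_atTop_of_neg (neg_lt_zero.2 S.δ_pos))).const_mul M
    simpa using this
  have hder := fun {a b : ℂ} {r ρ : ℝ} (hr : 0 ≤ r) (hρ : 0 ≤ ρ) (ha : sphere a r ⊆ Kᶜ)
    (hb : sphere b ρ ⊆ Kᶜ) => hasDerivAt_expCircle_comp hT B hC.continuousOn hr hρ ha hb t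
  have hcont := fun {a b : ℂ} {r ρ : ℝ} (hr : 0 ≤ r) (hρ : 0 ≤ ρ) (ha : sphere a r ⊆ Kᶜ)
    (hb : sphere b ρ ⊆ Kᶜ) => show Continuous fun s =>
      expCircle a r Φ s ∘L expCircle b ρ (resolvent T) (t - s) from
    continuous_iff_continuousAt.2 fun s => (hder hr hρ ha hb s).continuousAt
  have hu0 : Tendsto (fun s => -(expCircle S.b S.ρ Φ s ∘L expCircle S.a S.r (resolvent T) (t - s)))
      atBot (𝓝 0) := by
    refine (hJ tendsto_abs_atBot_atTop).congr' ?_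
    filter_upwards [eventually_lt_atBot 0, eventually_lt_atBot t] with s h1 h2
    rw [S.eval_of_neg _ h1, S.eval_of_pos _ (sub_pos.2 h2), ContinuousLinearMap.neg_comp]
  have hw0 : Tendsto (fun s => -(expCircle S.a S.r Φ s ∘L expCircle S.b S.ρ (resolvent T) (t - s)))
      atTop (𝓝 0) := by
    refine (hJ tendsto_abs_atTop_atTop).congr' ?_
    filter_upwards [eventually_gt_atTop 0, eventually_gt_atTop t] with s h1 h2
    rw [S.eval_of_pos _ h1, S.eval_of_neg _ (sub_neg.2 h2), ContinuousLinearMap.comp_neg]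
  have hu' : ∀ s, s < 0 → s < t → HasDerivAt
      (fun s => -(expCircle S.b S.ρ Φ s ∘L expCircle S.a S.r (resolvent T) (t - s)))
      (S.eval C s ∘L B ∘L S.eval (resolvent T) (t - s)) s := fun s h1 h2 => by
    rw [S.eval_of_neg _ h1, S.eval_of_pos _ (sub_pos.2 h2), ContinuousLinearMap.neg_comp]
    exact (hder S.ρ_nonneg S.r_nonneg S.sphere_right_subset S.sphere_left_subset s).neg
  have hw' : ∀ s, 0 < s → t < s → HasDerivAt
      (fun s => -(expCircle S.a S.r Φ s ∘L expCircle S.b S.ρ (resolvent T) (t - s)))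
      (S.eval C s ∘L B ∘L S.eval (resolvent T) (t - s)) s := fun s h1 h2 => by
    rw [S.eval_of_pos _ h1, S.eval_of_neg _ (sub_neg.2 h2), ContinuousLinearMap.comp_neg,
      ContinuousLinearMap.comp_neg]
    exact (hder S.r_nonneg S.ρ_nonneg S.sphere_left_subset S.sphere_right_subset s).neg
  have hu : Continuous fun s => -(expCircle S.b S.ρ Φ s ∘L
      expCircle S.a S.r (resolvent T) (t - s)) :=
    (hcont S.ρ_nonneg S.r_nonneg S.sphere_right_subset S.sphere_left_subset).neg
  have hw : Continuous fun s => -(expCircle S.a S.r Φ s ∘L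
      expCircle S.b S.ρ (resolvent T) (t - s)) :=
    (hcont S.r_nonneg S.ρ_nonneg S.sphere_left_subset S.sphere_right_subset).neg
  rcases ht.lt_or_gt with ht | ht
  · rw [integral_eq_of_piecewise_hasDerivAt ht.le hj hu
      (hcont S.ρ_nonneg S.ρ_nonneg S.sphere_right_subset S.sphere_right_subset) hw
      (fun s hs => hu' s (hs.trans ht) hs) (fun s hs => ?_)
      (fun s hs => hw' s hs (ht.trans hs)) hu0 hw0, S.eval_of_neg _ ht]
    -- Eliminating the left-circle values at `0` by the two jump relations, `E_a R(0) = 1 - E_b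
    -- R(0)` and `E_a Φ(0) = -E_b Φ(0)`, leaves only `-E_b Φ(t)`. The case `t > 0` below leaves `E_a
    -- Φ(t)` in the same way.
    · simp only [sub_self, sub_zero]
      rw [eq_sub_of_add_eq hjumpR, eq_neg_of_add_eq_zero_left hjumpΦ]
      ext x
      simp only [add_apply, sub_apply, neg_apply, ContinuousLinearMap.comp_apply, map_sub,
        one_apply_eq_self]
      abel
    · rw [S.eval_of_neg _ hs.2, S.eval_of_neg _ (sub_neg.2 hs.1), ContinuousLinearMap.comp_neg,
        ContinuousLinearMap.neg_comp, ContinuousLinearMap.comp_neg, neg_neg]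
      exact hder S.ρ_nonneg S.ρ_nonneg S.sphere_right_subset S.sphere_right_subset s
  · rw [integral_eq_of_piecewise_hasDerivAt ht.le hj hu
      (hcont S.r_nonneg S.r_nonneg S.sphere_left_subset S.sphere_left_subset) hw
      (fun s hs => hu' s hs (hs.trans ht)) (fun s hs => ?_)
      (fun s hs => hw' s (ht.trans hs) hs) hu0 hw0, S.eval_of_pos _ ht]
    · simp only [sub_self, sub_zero]
      rw [eq_sub_of_add_eq hjumpR, eq_neg_of_add_eq_zero_left hjumpΦ]
      ext x
      simp only [add_apply, sub_apply, neg_apply, ContinuousLinearMap.comp_apply, map_sub,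
        one_apply_eq_self]
      abel
    · rw [S.eval_of_pos _ hs.1, S.eval_of_pos _ (sub_pos.2 hs.2)]
      exact hder S.r_nonneg S.r_nonneg S.sphere_left_subset S.sphere_left_subset s

end ExpSplit

/-! ### Causal spectrum, operator chains and absolute convergence. -/

namespace BlockDecomp

variable {X : Type*} [NormedAddCommGroup X] [NormedSpace ℂ X] [CompleteSpace X] {n : ℕ}

/-- Closedness makes the causal operators a Banach algebra, so that the causal spectrum is compact
and can be compared with the spectrum in the full algebra. -/
theorem isClosed_causal (D : BlockDecomp X n) : IsClosed (D.causal : Set (X →L[ℂ] X)) := by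
  have h : (D.causal : Set (X →L[ℂ] X)) = ⋂ (i) (j) (_ : i < j), {T | D.block T i j = 0} := by
    ext T
    simp only [mem_iInter]
    rfl
  rw [h]
  refine isClosed_iInter fun i => isClosed_iInter fun j => isClosed_iInter fun _ =>
    isClosed_eq ?_ continuous_const
  exact continuous_const.clm_comp (continuous_id.clm_comp continuous_const)

instance (D : BlockDecomp X n) : CompleteSpace D.causal :=
  D.isClosed_causal.completeSpace_coe

theorem block_one (D : BlockDecomp X n) (i : Fin n) : D.block 1 i i = 1 := by
  ext1 x
  simp [block, component_incl]

/-- Taking a diagonal block is multiplicative on causal operators. -/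
theorem block_mul_self (D : BlockDecomp X n) {T U : X →L[ℂ] X} (hT : T ∈ D.causal)
    (hU : U ∈ D.causal) (i : Fin n) : D.block (T * U) i i = D.block T i i * D.block U i i := by
  rw [block_mul, Finset.sum_eq_single i]
  · rfl
  · intro k _ hk
    rcases lt_or_gt_of_ne hk with h | h
    · rw [hU k i h, ContinuousLinearMap.comp_zero]
    · rw [hT i k h, ContinuousLinearMap.zero_comp]
  · simp

/-- The diagonal block as a homomorphism from the algebra of causal operators. -/
def blockHom (D : BlockDecomp X n) (i : Fin n) :
    D.causal →ₐ[ℂ] (D.Summand i →L[ℂ] D.Summand i) :=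
  AlgHom.ofLinearMap
    { toFun := fun T => D.block T i i
      map_add' := fun T U => by ext1 x; simp [block]
      map_smul' := fun c T => by ext1 x; simp [block] }
    (D.block_one i) fun T U => D.block_mul_self T.2 U.2 i

theorem spectrum_block_subset (D : BlockDecomp X n) (A : D.causal) (i : Fin n) :
    spectrum ℂ (D.block (A : X →L[ℂ] X) i i) ⊆ spectrum ℂ A :=
  AlgHom.spectrum_apply_subset (D.blockHom i) A

theorem isCompact_causal_spectrum (D : BlockDecomp X n) (A : D.causal) :
    IsCompact (spectrum ℂ A) :=
  spectrum.isCompact (𝕜 := ℂ) (A := D.causal) A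

theorem isClosed_causal_spectrum (D : BlockDecomp X n) (A : D.causal) :
    IsClosed (spectrum ℂ A) :=
  (D.isCompact_causal_spectrum A).isClosed

/-- If the spectrum of a causal operator does not meet the imaginary axis, neither does its causal
spectrum. -/
theorem disjoint_causal_spectrum (D : BlockDecomp X n) (A : D.causal)
    (h : Disjoint (spectrum ℂ (A : X →L[ℂ] X)) {z : ℂ | z.re = 0}) :
    Disjoint (spectrum ℂ A) {z : ℂ | z.re = 0} := by
  refine disjoint_left.2 fun z hz (hz0 : z.re = 0) => ?_
  have hcl : IsClosed (D.causal : Set (X →L[ℂ] X)) := D.isClosed_causal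
  -- A causal spectral point outside `σ(A)` lies in a bounded component of the complement of `σ(A)`;
  -- on the imaginary axis that component would contain the whole unbounded axis.
  have hb := Subalgebra.spectrum_isBounded_connectedComponentIn (hS := hcl) D.causal A hz
  have hpre : IsPreconnected (range fun y : ℝ => (y : ℂ) * Complex.I) :=
    isPreconnected_range (by fun_prop)
  have hsub : (range fun y : ℝ => (y : ℂ) * Complex.I) ⊆
      connectedComponentIn (spectrum ℂ (A : X →L[ℂ] X))ᶜ z := by
    refine hpre.subset_connectedComponentIn ⟨z.im, ?_⟩ ?_
    · apply Complex.ext <;> simp [hz0]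
    · rintro _ ⟨y, rfl⟩ hy
      exact h.le_bot ⟨hy, by simp⟩
  obtain ⟨R, hR0, hR⟩ := (hb.subset hsub).exists_pos_norm_lt
  have := hR _ ⟨R, rfl⟩
  simp [abs_of_pos hR0] at this

/-- `chain` is built from the first factor, whereas the outermost integral runs over the last
variable; the induction needs the last factor split off. -/
theorem chain_castSucc (D : BlockDecomp X n) (T : X →L[ℂ] X) (k : ℕ) (idx : Fin (k + 2) → Fin n)
    (Φ : (j : Fin (k + 2)) → (D.Summand (idx j) →L[ℂ] D.Summand (idx j))) :
    D.chain T (k + 1) idx Φ =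
      D.chain T k (fun j => idx j.castSucc) (fun j => Φ j.castSucc) ∘L
        D.block T (idx (Fin.last k).castSucc) (idx (Fin.last (k + 1))) ∘L Φ (Fin.last (k + 1)) := by
  induction k with
  | zero => rfl
  | succ k ih =>
    have h := ih (fun j => idx j.succ) (fun j => Φ j.succ)
    have h2 : D.chain T (k + 1 + 1) idx Φ = Φ 0 ∘L D.block T (idx 0) (idx (Fin.succ 0)) ∘L
      D.chain T (k + 1) (fun j => idx j.succ) (fun j => Φ j.succ) := rfl
    rw [h2, h]
    rfl

theorem exists_norm_chain_le (D : BlockDecomp X n) (T : X →L[ℂ] X) (k : ℕ)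
    (idx : Fin (k + 1) → Fin n) : ∃ M : ℝ, 0 ≤ M ∧ ∀ Φ, ‖D.chain T k idx Φ‖ ≤ M * ∏ j, ‖Φ j‖ := by
  induction k with
  | zero => exact ⟨1, zero_le_one, fun Φ => by simp [chain]⟩
  | succ k ih =>
    obtain ⟨M, hM0, hM⟩ := ih fun j => idx j.succ
    refine ⟨‖D.block T (idx 0) (idx (Fin.succ 0))‖ * M, by positivity, fun Φ => ?_⟩
    rw [Fin.prod_univ_succ]
    calc ‖D.chain T (k + 1) idx Φ‖
        ≤ ‖Φ 0‖ * (‖D.block T (idx 0) (idx (Fin.succ 0))‖ * (M * ∏ j : Fin (k + 1), ‖Φ j.succ‖)) :=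
          (ContinuousLinearMap.opNorm_comp_le _ _).trans (mul_le_mul_of_nonneg_left
            ((ContinuousLinearMap.opNorm_comp_le _ _).trans
              (mul_le_mul_of_nonneg_left (hM _) (norm_nonneg _))) (norm_nonneg _))
      _ = _ := by ring

theorem stronglyMeasurable_chain (D : BlockDecomp X n) (T : X →L[ℂ] X) {α : Type*}
    [MeasurableSpace α] (k : ℕ) (idx : Fin (k + 1) → Fin n)
    {Φ : α → (j : Fin (k + 1)) → (D.Summand (idx j) →L[ℂ] D.Summand (idx j))}
    (hΦ : ∀ j, StronglyMeasurable fun s => Φ s j) :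
    StronglyMeasurable fun s => D.chain T k idx (Φ s) := by
  induction k with
  | zero => exact hΦ 0
  | succ k ih =>
    exact ExpSplit.stronglyMeasurable_clm_comp (hΦ 0)
      (ExpSplit.stronglyMeasurable_clm_comp stronglyMeasurable_const
        (ih (fun j => idx j.succ) (Φ := fun s j => Φ s j.succ) fun j => hΦ j.succ))

/-- The integrand `(z - A_{i₁i₁})⁻¹ A_{i₁i₂} ⋯ (z - A_{i_mi_m})⁻¹` of the divided difference. -/
def resolventChain (D : BlockDecomp X n) (A : D.causal) {k : ℕ}
    (idx : Fin (k + 1) → Fin n) (z : ℂ) :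
    D.Summand (idx (Fin.last k)) →L[ℂ] D.Summand (idx 0) :=
  D.chain (A : X →L[ℂ] X) k idx fun j => resolvent (D.block (A : X →L[ℂ] X) (idx j) (idx j)) z

theorem differentiableOn_resolventChain (D : BlockDecomp X n) (A : D.causal) {k : ℕ}
    (idx : Fin (k + 1) → Fin n) :
    DifferentiableOn ℂ (D.resolventChain A idx) (spectrum ℂ A)ᶜ := by
  have hR : ∀ i, DifferentiableOn ℂ (resolvent (D.block (A : X →L[ℂ] X) i i)) (spectrum ℂ A)ᶜ :=
    fun i => ExpSplit.differentiableOn_resolvent (D.spectrum_block_subset A i)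
  induction k with
  | zero => exact hR _
  | succ k ih =>
    exact (hR (idx 0)).clm_comp ((differentiableOn_const _).clm_comp (ih fun j => idx j.succ))

/-- Decay at infinity is what removes the jump at `0` when one more resolvent is appended. -/
theorem tendsto_resolventChain (D : BlockDecomp X n) (A : D.causal) {k : ℕ}
    (idx : Fin (k + 1) → Fin n) :
    Tendsto (D.resolventChain A idx) (Bornology.cobounded ℂ) (𝓝 0) := by
  have hR : ∀ i, Tendsto (resolvent (D.block (A : X →L[ℂ] X) i i)) (Bornology.cobounded ℂ) (𝓝 0) :=
    fun i => spectrum.resolvent_tendsto_cobounded _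
  induction k with
  | zero => exact hR _
  | succ k ih =>
    let B := D.block (A : X →L[ℂ] X) (idx 0) (idx (Fin.succ 0))
    have h := ((continuous_fst.clm_comp ((continuous_const (y := B)).clm_comp
      continuous_snd)).tendsto (0, 0)).comp ((hR (idx 0)).prodMk_nhds (ih fun j => idx j.succ))
    simp only [ContinuousLinearMap.zero_comp] at h
    exact h

theorem resolventChain_castSucc (D : BlockDecomp X n) (A : D.causal) {k : ℕ}
    (idx : Fin (k + 2) → Fin n) :
    D.resolventChain A idx = fun z => D.resolventChain A (fun j => idx j.castSucc) z ∘L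
      D.block (A : X →L[ℂ] X) (idx (Fin.last k).castSucc) (idx (Fin.last (k + 1))) ∘L
        resolvent (D.block (A : X →L[ℂ] X) (idx (Fin.last (k + 1))) (idx (Fin.last (k + 1)))) z :=
  funext fun _ => D.chain_castSucc (A : X →L[ℂ] X) k idx _

/-- With the last node fixed at `r`, the preceding factors form the shorter integrand with endpoint
`r`, and only the last factor depends on `t`. -/
theorem convIntegrand_snoc (D : BlockDecomp X n) (f : ℝ → ℂ → ℂ) (A : D.causal) {k : ℕ}
    (idx : Fin (k + 2) → Fin n) (t r : ℝ) (s : Fin k → ℝ) :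
    D.convIntegrand f A idx t (Fin.snoc (α := fun _ => ℝ) s r) =
      D.convIntegrand f A (fun j => idx j.castSucc) r s ∘L
        D.block (A : X →L[ℂ] X) (idx (Fin.last k).castSucc) (idx (Fin.last (k + 1))) ∘L
          opFun (f (t - r))
            (D.block (A : X →L[ℂ] X) (idx (Fin.last (k + 1))) (idx (Fin.last (k + 1)))) := by
  have hp : ∀ i : Fin (k + 2), (Fin.cons (α := fun _ => ℝ) 0 (Fin.snoc (α := fun _ => ℝ)
      (Fin.snoc (α := fun _ => ℝ) s r) t) : Fin (k + 3) → ℝ) i.castSucc =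
      (Fin.cons (α := fun _ => ℝ) 0 (Fin.snoc (α := fun _ => ℝ) s r) : Fin (k + 2) → ℝ) i := by
    intro i
    rw [Fin.cons_snoc_eq_snoc_cons, Fin.snoc_castSucc]
  have h1 : (Fin.cons (α := fun _ => ℝ) 0 (Fin.snoc (α := fun _ => ℝ)
      (Fin.snoc (α := fun _ => ℝ) s r) t) : Fin (k + 3) → ℝ) (Fin.last (k + 1)).succ = t := by
    rw [Fin.cons_succ, Fin.snoc_last]
  have h2 : (Fin.cons (α := fun _ => ℝ) 0 (Fin.snoc (α := fun _ => ℝ)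
      (Fin.snoc (α := fun _ => ℝ) s r) t) : Fin (k + 3) → ℝ) (Fin.last (k + 1)).castSucc = r := by
    rw [hp, ← Fin.succ_last, Fin.cons_succ, Fin.snoc_last]
  simp only [convIntegrand]
  rw [chain_castSucc]
  simp only [h1, h2, hp, Fin.succ_castSucc]
  rfl

theorem abs_sub_le_sum {m : ℕ} (p : Fin (m + 1) → ℝ) (i : Fin (m + 1)) :
    |p i - p 0| ≤ ∑ j : Fin m, |p j.succ - p j.castSucc| := by
  induction m with
  | zero =>
    obtain rfl : i = 0 := by ext; omega
    simp
  | succ m ih =>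
    rw [Fin.sum_univ_succ]
    refine Fin.cases ?_ (fun i => ?_) i
    · rw [sub_self, abs_zero]
      positivity
    · have h := ih (fun j => p j.succ) i
      have h2 := abs_sub_le (p i.succ) (p (Fin.succ 0)) (p 0)
      simp only [Fin.succ_castSucc] at h
      rw [Fin.castSucc_zero]
      linarith

theorem sum_sub_castSucc {m : ℕ} (p : Fin (m + 1) → ℝ) :
    ∑ j : Fin m, (p j.succ - p j.castSucc) = p (Fin.last m) - p 0 := by
  have h1 := Fin.sum_univ_succ p
  have h2 := Fin.sum_univ_castSucc p
  rw [Finset.sum_sub_distrib]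
  linarith

theorem integrable_convIntegrand (D : BlockDecomp X n) {f : ℝ → ℂ → ℂ} (A : D.causal)
    (S : ExpSplit f (spectrum ℂ A)) {k : ℕ} (idx : Fin (k + 1) → Fin n) (t : ℝ) :
    Integrable (D.convIntegrand f A idx t) := by
  let p : (Fin k → ℝ) → Fin (k + 2) → ℝ := fun s =>
    Fin.cons (α := fun _ => ℝ) 0 (Fin.snoc (α := fun _ => ℝ) s t)
  have hp0 : ∀ s, p s 0 = 0 := fun s => rfl
  have hpl : ∀ s, p s (Fin.last (k + 1)) = t := fun s => by
    simp only [p, ← Fin.succ_last, Fin.cons_succ, Fin.snoc_last]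
  have hpi : ∀ s (i : Fin k), p s i.castSucc.succ = s i := fun s i => by
    simp only [p, Fin.cons_succ, Fin.snoc_castSucc]
  have hpm : ∀ i, Measurable fun s => p s i := by
    intro i
    refine Fin.cases ?_ (fun i => ?_) i
    · simp only [hp0]; fun_prop
    · refine Fin.lastCases ?_ (fun i => ?_) i
      · simp only [Fin.succ_last, hpl]; fun_prop
      · simp only [hpi]; fun_prop
  have hR : ∀ i, ContinuousOn (resolvent (D.block (A : X →L[ℂ] X) i i)) (spectrum ℂ A)ᶜ :=
    fun i => (ExpSplit.differentiableOn_resolvent (D.spectrum_block_subset A i)).continuousOn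
  have hconv : D.convIntegrand f A idx t = fun s => D.chain (A : X →L[ℂ] X) k idx fun j =>
      S.eval (resolvent (D.block (A : X →L[ℂ] X) (idx j) (idx j)))
        (p s j.succ - p s j.castSucc) := by
    funext s
    simp only [convIntegrand, S.opFun_eq (D.spectrum_block_subset A _), p]
  obtain ⟨M, hM0, hM⟩ := D.exists_norm_chain_le (A : X →L[ℂ] X) k idx
  choose M' hM0' hM' using fun j => S.exists_norm_eval_le (hR (idx j))
  -- The exponents `c (p_{j+1} - p_j)` telescope to `ct`. Each `|s_i|` is at most the sum of the
  -- absolute increments, so the sum of all `|s_i|` is at most `k`, hence at most `k + 1`, times it;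
  -- this explains the rate `δ / (k + 1)` and gives a majorant that is a product over the variables.
  have hint : Integrable fun s : Fin k → ℝ =>
      M * ((∏ j, M' j) * (Real.exp (S.c * t) * ∏ i, Real.exp (-(S.δ / (k + 1)) * |s i|))) := by
    refine Integrable.const_mul (Integrable.const_mul (Integrable.const_mul ?_ _) _) _
    exact Integrable.fintype_prod (f := fun _ x => Real.exp (-(S.δ / (k + 1)) * |x|)) fun _ =>
      integrable_exp_neg_mul_abs (div_pos S.δ_pos (by positivity))
  rw [hconv]
  refine hint.mono' (D.stronglyMeasurable_chain _ k idx fun j =>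
    (S.stronglyMeasurable_eval (hR (idx j))).comp_measurable
      ((hpm _).sub (hpm _))).aestronglyMeasurable (ae_of_all _ fun s => ?_)
  refine (hM _).trans (mul_le_mul_of_nonneg_left ?_ hM0)
  refine (Finset.prod_le_prod (fun _ _ => norm_nonneg _) fun j _ => hM' j _).trans ?_
  rw [Finset.prod_mul_distrib]
  refine mul_le_mul_of_nonneg_left ?_ (Finset.prod_nonneg fun j _ => hM0' j)
  rw [← Real.exp_sum, ← Real.exp_sum, ← Real.exp_add]
  refine Real.exp_le_exp.2 ?_
  rw [Finset.sum_sub_distrib, ← Finset.mul_sum, ← Finset.mul_sum, sum_sub_castSucc, hpl, hp0,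
    ← Finset.mul_sum, sub_zero, neg_mul, ← sub_eq_add_neg, sub_le_sub_iff_left, div_mul_eq_mul_div,
    div_le_iff₀ (by positivity), mul_assoc]
  refine mul_le_mul_of_nonneg_left ?_ S.δ_pos.le
  have h0 : 0 ≤ ∑ j : Fin (k + 1), |p s j.succ - p s j.castSucc| := by positivity
  have h1 : ∑ i, |s i| ≤ ∑ _i : Fin k, ∑ j : Fin (k + 1), |p s j.succ - p s j.castSucc| :=
    Finset.sum_le_sum fun i _ => by
      have := abs_sub_le_sum (p s) i.castSucc.succ
      rwa [hpi, hp0, sub_zero] at this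
  rw [Finset.sum_const, Finset.card_univ, Fintype.card_fin, nsmul_eq_mul] at h1
  linarith

end BlockDecomp

/-! ### One-sided convolutions, seen through bounded linear maps. -/

namespace ExpSplit

variable {f : ℝ → ℂ → ℂ} {K : Set ℂ} (S : ExpSplit f K)
  {V W Z E : Type*} [NormedAddCommGroup V] [NormedSpace ℂ V] [NormedAddCommGroup W]
  [NormedSpace ℂ W] [NormedAddCommGroup Z] [NormedSpace ℂ Z] [NormedAddCommGroup E]
  [NormedSpace ℂ E]

theorem eval_zero (F : ℂ → E) : S.eval F 0 = 0 := by
  simp [eval]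

/-- An integral over a circle of radius zero vanishes, so a degenerate right disc makes the
transform one-sided. -/
theorem eval_of_nonpos (hS : S.ρ = 0) (F : ℂ → E) {t : ℝ} (ht : t ≤ 0) : S.eval F t = 0 := by
  rcases ht.lt_or_eq with ht | rfl
  · simp [S.eval_of_neg F ht, hS, expCircle]
  · exact S.eval_zero F

theorem eval_of_nonneg (hS : S.r = 0) (F : ℂ → E) {t : ℝ} (ht : 0 ≤ t) : S.eval F t = 0 := by
  rcases ht.lt_or_eq with ht | rfl
  · simp [S.eval_of_pos F ht, hS, expCircle]
  · exact S.eval_zero F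

/-- The map `Y ↦ B (Y U f_{t-r}(T))`. -/
def compMap (U : W →L[ℂ] V) (T : W →L[ℂ] W) (t : ℝ) (B : (W →L[ℂ] Z) →L[ℂ] E) (r : ℝ) :
    (V →L[ℂ] Z) →L[ℂ] E :=
  B ∘L (ContinuousLinearMap.compL ℂ W V Z).flip (U ∘L S.eval (resolvent T) (t - r))

theorem compMap_apply (U : W →L[ℂ] V) (T : W →L[ℂ] W) (t : ℝ) (B : (W →L[ℂ] Z) →L[ℂ] E) (r : ℝ)
    (Y : V →L[ℂ] Z) : S.compMap U T t B r Y = B (Y ∘L U ∘L S.eval (resolvent T) (t - r)) :=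
  rfl

theorem compMap_eq_zero {U : W →L[ℂ] V} {T : W →L[ℂ] W} {t r : ℝ} {B : (W →L[ℂ] Z) →L[ℂ] E}
    {Y : V →L[ℂ] Z} (h : S.eval (resolvent T) (t - r) = 0) : S.compMap U T t B r Y = 0 := by
  rw [compMap_apply, h, ContinuousLinearMap.comp_zero, ContinuousLinearMap.comp_zero, map_zero]

variable [CompleteSpace V] [CompleteSpace W] [CompleteSpace Z] [CompleteSpace E]

theorem integral_compMap (hK : IsClosed K) {T : W →L[ℂ] W} (hT : spectrum ℂ T ⊆ K) (U : W →L[ℂ] V)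
    {C : ℂ → V →L[ℂ] Z} (hC : DifferentiableOn ℂ C Kᶜ)
    (hC0 : Tendsto C (Bornology.cobounded ℂ) (𝓝 0)) {t : ℝ} (ht : t ≠ 0)
    (B : (W →L[ℂ] Z) →L[ℂ] E) : ∫ r, S.compMap U T t B r (S.eval C r) =
      B (S.eval (fun z => C z ∘L U ∘L resolvent T z) t) := by
  rw [← S.eval_comp_eq_integral hK hT U hC hC0 ht]
  exact B.integral_comp_comm (S.integrable_eval_comp hT U hC.continuousOn t)

/-- The integral over `(0, t]` equals that over the line: the first factor vanishes for `r ≤ 0` and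
the second for `r ≥ t`. -/
theorem intervalIntegral_compMap_of_pos (hS : S.ρ = 0) (hK : IsClosed K) {T : W →L[ℂ] W}
    (hT : spectrum ℂ T ⊆ K) (U : W →L[ℂ] V) {C : ℂ → V →L[ℂ] Z} (hC : DifferentiableOn ℂ C Kᶜ)
    (hC0 : Tendsto C (Bornology.cobounded ℂ) (𝓝 0)) {t : ℝ} (ht : 0 < t)
    (B : (W →L[ℂ] Z) →L[ℂ] E) : ∫ r in (0 : ℝ)..t, S.compMap U T t B r (S.eval C r) =
      B (S.eval (fun z => C z ∘L U ∘L resolvent T z) t) := by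
  rw [← S.integral_compMap hK hT U hC hC0 ht.ne' B, intervalIntegral.integral_of_le ht.le]
  refine setIntegral_eq_integral_of_forall_compl_eq_zero fun r hr => ?_
  rcases le_or_gt r 0 with h | h
  · rw [S.eval_of_nonpos hS _ h, map_zero]
  · refine S.compMap_eq_zero (S.eval_of_nonpos hS _ ?_)
    by_contra! h3
    exact hr ⟨h, (sub_pos.1 h3).le⟩

theorem intervalIntegral_compMap_of_neg (hS : S.r = 0) (hK : IsClosed K) {T : W →L[ℂ] W}
    (hT : spectrum ℂ T ⊆ K) (U : W →L[ℂ] V) {C : ℂ → V →L[ℂ] Z} (hC : DifferentiableOn ℂ C Kᶜ)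
    (hC0 : Tendsto C (Bornology.cobounded ℂ) (𝓝 0)) {t : ℝ} (ht : t < 0)
    (B : (W →L[ℂ] Z) →L[ℂ] E) : ∫ r in t..(0 : ℝ), S.compMap U T t B r (S.eval C r) =
      B (S.eval (fun z => C z ∘L U ∘L resolvent T z) t) := by
  rw [← S.integral_compMap hK hT U hC hC0 ht.ne B, intervalIntegral.integral_of_le ht.le]
  refine setIntegral_eq_integral_of_forall_compl_eq_zero fun r hr => ?_
  rcases le_or_gt r 0 with h | h
  · refine S.compMap_eq_zero (S.eval_of_nonneg hS _ ?_)
    by_contra! h3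
    exact hr ⟨sub_neg.1 h3, h⟩
  · rw [S.eval_of_nonneg hS _ h.le, map_zero]

end ExpSplit

/-! ### Induction for the iterated integrals. -/

namespace BlockDecomp

variable {X : Type*} [NormedAddCommGroup X] [NormedSpace ℂ X] [CompleteSpace X] {n : ℕ}

section Iterated

variable (D : BlockDecomp X n) {f : ℝ → ℂ → ℂ} (A : D.causal) (S : ExpSplit f (spectrum ℂ A))
  {E : Type*} [NormedAddCommGroup E] [NormedSpace ℂ E]

theorem convIntegrand_zero (idx : Fin 1 → Fin n) (t : ℝ) (s : Fin 0 → ℝ) :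
    D.convIntegrand f A idx t s = S.eval (D.resolventChain A idx) t := by
  have h : D.convIntegrand f A idx t s =
      opFun (f (t - 0)) (D.block (A : X →L[ℂ] X) (idx 0) (idx 0)) := rfl
  rw [h, sub_zero, S.opFun_eq (D.spectrum_block_subset A _)]
  rfl

theorem apply_convIntegrand_snoc {k : ℕ} (idx : Fin (k + 2) → Fin n) (t : ℝ)
    (B : (D.Summand (idx (Fin.last (k + 1))) →L[ℂ] D.Summand (idx (Fin.castSucc 0))) →L[ℂ] E)
    (r : ℝ) (s : Fin k → ℝ) :
    B (D.convIntegrand f A idx t (Fin.snoc (α := fun _ => ℝ) s r)) =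
      S.compMap
        (D.block (A : X →L[ℂ] X) (idx (Fin.last k).castSucc) (idx (Fin.last (k + 1))))
        (D.block (A : X →L[ℂ] X) (idx (Fin.last (k + 1))) (idx (Fin.last (k + 1)))) t B r
        (D.convIntegrand f A (fun j => idx j.castSucc) r s) := by
  rw [ExpSplit.compMap_apply, ← S.opFun_eq (D.spectrum_block_subset A _)]
  exact congrArg B (D.convIntegrand_snoc f A idx t r s)

theorem apply_eval_resolventChain {k : ℕ} (idx : Fin (k + 2) → Fin n) (t : ℝ)
    (B : (D.Summand (idx (Fin.last (k + 1))) →L[ℂ] D.Summand (idx (Fin.castSucc 0))) →L[ℂ] E) :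
    B (S.eval (fun z => D.resolventChain A (fun j => idx j.castSucc) z ∘L
      D.block (A : X →L[ℂ] X) (idx (Fin.last k).castSucc) (idx (Fin.last (k + 1))) ∘L
        resolvent (D.block (A : X →L[ℂ] X) (idx (Fin.last (k + 1))) (idx (Fin.last (k + 1)))) z)
          t) =
      B (S.eval (D.resolventChain A idx) t) :=
  congrArg (fun F => B (S.eval F t)) (D.resolventChain_castSucc A idx).symm

theorem hasDividedDifference {k : ℕ} (idx : Fin (k + 1) → Fin n) (t : ℝ) :
    D.HasDividedDifference (f t) A idx (S.eval (D.resolventChain A idx) t) :=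
  ⟨⟨_, S.surrounds t⟩, fun _ hΓ => S.eval_of_surrounds (D.isClosed_causal_spectrum A) le_rfl
    (D.differentiableOn_resolventChain A idx) hΓ⟩

variable [CompleteSpace E]

theorem integral_compMap_resolventChain {k : ℕ} (idx : Fin (k + 2) → Fin n) {t : ℝ} (ht : t ≠ 0)
    (B : (D.Summand (idx (Fin.last (k + 1))) →L[ℂ] D.Summand (idx (Fin.castSucc 0))) →L[ℂ] E) :
    ∫ r, S.compMap
        (D.block (A : X →L[ℂ] X) (idx (Fin.last k).castSucc) (idx (Fin.last (k + 1))))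
        (D.block (A : X →L[ℂ] X) (idx (Fin.last (k + 1))) (idx (Fin.last (k + 1)))) t B r
        (S.eval (D.resolventChain A (fun j => idx j.castSucc)) r) =
      B (S.eval (D.resolventChain A idx) t) := by
  rw [← apply_eval_resolventChain]
  exact S.integral_compMap (D.isClosed_causal_spectrum A)
    (D.spectrum_block_subset A _) _
    (D.differentiableOn_resolventChain A fun j => idx j.castSucc)
      (D.tendsto_resolventChain A fun j => idx j.castSucc) ht B

theorem iterIntegral_convIntegrand_succ {k : ℕ} (idx : Fin (k + 2) → Fin n) {t : ℝ}
    (ht : t ≠ 0)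
    (B : (D.Summand (idx (Fin.last (k + 1))) →L[ℂ] D.Summand (idx (Fin.castSucc 0))) →L[ℂ] E)
    (ih : ∀ r, r ≠ 0 → ∀ B : (D.Summand (idx (Fin.last k).castSucc) →L[ℂ]
        D.Summand (idx (Fin.castSucc 0))) →L[ℂ] E,
      iterIntegral k (fun s => B (D.convIntegrand f A (fun j => idx j.castSucc) r s)) =
        B (S.eval (D.resolventChain A (fun j => idx j.castSucc)) r)) :
    iterIntegral (k + 1) (fun s => B (D.convIntegrand f A idx t s)) =
      B (S.eval (D.resolventChain A idx) t) := by
  rw [← D.integral_compMap_resolventChain A S idx ht]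
  -- The induction hypothesis is not available at `r = 0`, which is a null set for the outer
  -- integral.
  have hne : ∀ᵐ r : ℝ, r ≠ 0 := by simp [ae_iff]
  refine integral_congr_ae (hne.mono fun r hr => ?_)
  exact (congrArg (iterIntegral k) (funext (D.apply_convIntegrand_snoc A S idx t B r))).trans
    (ih r hr _)

/-- The arbitrary bounded map `B` carries the factors already split off on the right: each step
replaces `B` by `Y ↦ B (Y U f_{t-r}(T))`, so no operator has to be pulled out of an iterated
integral. The theorem uses `B = id`. -/
theorem iterIntegral_convIntegrand {k : ℕ} (idx : Fin (k + 1) → Fin n) {t : ℝ}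
    (ht : t ≠ 0) (B : (D.Summand (idx (Fin.last k)) →L[ℂ] D.Summand (idx 0)) →L[ℂ] E) :
    iterIntegral k (fun s => B (D.convIntegrand f A idx t s)) =
      B (S.eval (D.resolventChain A idx) t) := by
  induction k generalizing t with
  | zero => exact congrArg B (D.convIntegrand_zero A S idx t _)
  | succ k ih =>
    exact D.iterIntegral_convIntegrand_succ A S idx ht B fun _ hr B' =>
      ih (fun j => idx j.castSucc) hr B'

theorem intervalIntegral_compMap_resolventChain_of_pos (hS : S.ρ = 0) {k : ℕ} (idx : Fin (k + 2) → Fin n)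
    {t : ℝ} (ht : 0 < t)
    (B : (D.Summand (idx (Fin.last (k + 1))) →L[ℂ] D.Summand (idx (Fin.castSucc 0))) →L[ℂ] E) :
    ∫ r in (0 : ℝ)..t, S.compMap
        (D.block (A : X →L[ℂ] X) (idx (Fin.last k).castSucc) (idx (Fin.last (k + 1))))
        (D.block (A : X →L[ℂ] X) (idx (Fin.last (k + 1))) (idx (Fin.last (k + 1)))) t B r
        (S.eval (D.resolventChain A (fun j => idx j.castSucc)) r) =
      B (S.eval (D.resolventChain A idx) t) := by
  rw [← apply_eval_resolventChain]
  exact S.intervalIntegral_compMap_of_pos hS (D.isClosed_causal_spectrum A)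
    (D.spectrum_block_subset A _) _
    (D.differentiableOn_resolventChain A fun j => idx j.castSucc)
      (D.tendsto_resolventChain A fun j => idx j.castSucc) ht B

theorem iterIntegralPos_convIntegrand_succ (hS : S.ρ = 0) {k : ℕ}
    (idx : Fin (k + 2) → Fin n) {t : ℝ} (ht : 0 < t)
    (B : (D.Summand (idx (Fin.last (k + 1))) →L[ℂ] D.Summand (idx (Fin.castSucc 0))) →L[ℂ] E)
    (ih : ∀ r, 0 < r → ∀ B : (D.Summand (idx (Fin.last k).castSucc) →L[ℂ]
        D.Summand (idx (Fin.castSucc 0))) →L[ℂ] E,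
      iterIntegralPos k (fun s => B (D.convIntegrand f A (fun j => idx j.castSucc) r s)) r =
        B (S.eval (D.resolventChain A (fun j => idx j.castSucc)) r)) :
    iterIntegralPos (k + 1) (fun s => B (D.convIntegrand f A idx t s)) t =
      B (S.eval (D.resolventChain A idx) t) := by
  rw [← D.intervalIntegral_compMap_resolventChain_of_pos A S hS idx ht]
  refine intervalIntegral.integral_congr_Ioo_of_le ht.le fun r hr => ?_
  exact (congrArg (fun F => iterIntegralPos k F r)
    (funext (D.apply_convIntegrand_snoc A S idx t B r))).trans (ih r hr.1 _)

theorem iterIntegralPos_convIntegrand (hS : S.ρ = 0) {k : ℕ} (idx : Fin (k + 1) → Fin n) {t : ℝ}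
    (ht : 0 < t) (B : (D.Summand (idx (Fin.last k)) →L[ℂ] D.Summand (idx 0)) →L[ℂ] E) :
    iterIntegralPos k (fun s => B (D.convIntegrand f A idx t s)) t =
      B (S.eval (D.resolventChain A idx) t) := by
  induction k generalizing t with
  | zero => exact congrArg B (D.convIntegrand_zero A S idx t _)
  | succ k ih =>
    exact D.iterIntegralPos_convIntegrand_succ A S hS idx ht B fun _ hr B' =>
      ih (fun j => idx j.castSucc) hr B'

theorem intervalIntegral_compMap_resolventChain_of_neg (hS : S.r = 0) {k : ℕ} (idx : Fin (k + 2) → Fin n)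
    {t : ℝ} (ht : t < 0)
    (B : (D.Summand (idx (Fin.last (k + 1))) →L[ℂ] D.Summand (idx (Fin.castSucc 0))) →L[ℂ] E) :
    ∫ r in t..(0 : ℝ), S.compMap
        (D.block (A : X →L[ℂ] X) (idx (Fin.last k).castSucc) (idx (Fin.last (k + 1))))
        (D.block (A : X →L[ℂ] X) (idx (Fin.last (k + 1))) (idx (Fin.last (k + 1)))) t B r
        (S.eval (D.resolventChain A (fun j => idx j.castSucc)) r) =
      B (S.eval (D.resolventChain A idx) t) := by
  rw [← apply_eval_resolventChain]
  exact S.intervalIntegral_compMap_of_neg hS (D.isClosed_causal_spectrum A)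
    (D.spectrum_block_subset A _) _
    (D.differentiableOn_resolventChain A fun j => idx j.castSucc)
      (D.tendsto_resolventChain A fun j => idx j.castSucc) ht B

theorem iterIntegralNeg_convIntegrand_succ (hS : S.r = 0) {k : ℕ}
    (idx : Fin (k + 2) → Fin n) {t : ℝ} (ht : t < 0)
    (B : (D.Summand (idx (Fin.last (k + 1))) →L[ℂ] D.Summand (idx (Fin.castSucc 0))) →L[ℂ] E)
    (ih : ∀ r, r < 0 → ∀ B : (D.Summand (idx (Fin.last k).castSucc) →L[ℂ]
        D.Summand (idx (Fin.castSucc 0))) →L[ℂ] E,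
      iterIntegralNeg k (fun s => B (D.convIntegrand f A (fun j => idx j.castSucc) r s)) r =
        B (S.eval (D.resolventChain A (fun j => idx j.castSucc)) r)) :
    iterIntegralNeg (k + 1) (fun s => B (D.convIntegrand f A idx t s)) t =
      B (S.eval (D.resolventChain A idx) t) := by
  rw [← D.intervalIntegral_compMap_resolventChain_of_neg A S hS idx ht]
  refine intervalIntegral.integral_congr_Ioo_of_le ht.le fun r hr => ?_
  exact (congrArg (fun F => iterIntegralNeg k F r)
    (funext (D.apply_convIntegrand_snoc A S idx t B r))).trans (ih r hr.2 _)

theorem iterIntegralNeg_convIntegrand (hS : S.r = 0) {k : ℕ} (idx : Fin (k + 1) → Fin n) {t : ℝ}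
    (ht : t < 0) (B : (D.Summand (idx (Fin.last k)) →L[ℂ] D.Summand (idx 0)) →L[ℂ] E) :
    iterIntegralNeg k (fun s => B (D.convIntegrand f A idx t s)) t =
      B (S.eval (D.resolventChain A idx) t) := by
  induction k generalizing t with
  | zero => exact congrArg B (D.convIntegrand_zero A S idx t _)
  | succ k ih =>
    exact D.iterIntegralNeg_convIntegrand_succ A S hS idx ht B fun _ hr B' =>
      ih (fun j => idx j.castSucc) hr B'

end Iterated

end BlockDecomp

/-! ### Discs for the three families of functions. -/

theorem analyticAt_expPlus (t : ℝ) (z : ℂ) : AnalyticAt ℂ (expPlus t) z := by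
  unfold expPlus
  split_ifs
  · fun_prop
  · exact analyticAt_const

theorem analyticAt_expMinus (t : ℝ) (z : ℂ) : AnalyticAt ℂ (expMinus t) z := by
  unfold expMinus
  split_ifs
  · fun_prop
  · exact analyticAt_const

theorem greenFun_of_re_neg (t : ℝ) {z : ℂ} (hz : z.re < 0) : greenFun t z = expPlus t z := by
  rw [greenFun, if_neg hz.not_gt, if_pos hz]

theorem greenFun_of_re_pos (t : ℝ) {z : ℂ} (hz : 0 < z.re) : greenFun t z = expMinus t z := by
  rw [greenFun, if_pos hz]

theorem abs_re_sub_le_of_mem_closedBall {a z : ℂ} {r : ℝ} (hz : z ∈ Metric.closedBall a r) :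
    |z.re - a.re| ≤ r := by
  rw [← Complex.sub_re]
  exact (Complex.abs_re_le_norm _).trans (by rwa [← dist_eq_norm])

theorem exists_expSplit_expPlus {K : Set ℂ} (hK : IsCompact K) :
    ∃ S : ExpSplit expPlus K, S.ρ = 0 := by
  obtain ⟨R, hR0, hR⟩ := hK.isBounded.exists_pos_norm_lt
  -- The left disc contains all of `K`; the right one is a point at distance `2` beyond it, with the
  -- separating line `Re z = R + 1` midway.
  exact ⟨{ a := 0, b := ((R + 2 : ℝ) : ℂ), r := R, ρ := 0, c := R + 1, δ := 1
           r_nonneg := hR0.le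
           ρ_nonneg := le_rfl
           δ_pos := one_pos
           re_le := fun z hz => by
             have := (abs_le.1 (abs_re_sub_le_of_mem_closedBall hz)).2
             rw [Complex.zero_re] at this
             linarith
           le_re := fun z hz => by
             have := (abs_le.1 (abs_re_sub_le_of_mem_closedBall hz)).1
             rw [Complex.ofReal_re] at this
             linarith
           subset_union := fun z hz => .inl (by simpa using hR z hz)
           analyticAt_left := fun t z _ => analyticAt_expPlus t z
           analyticAt_right := fun t z _ => analyticAt_expPlus t z
           eq_left := fun _ _ _ _ => rfl
           eq_right := fun _ h => absurd rfl h }, rfl⟩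

theorem exists_expSplit_expMinus {K : Set ℂ} (hK : IsCompact K) :
    ∃ S : ExpSplit expMinus K, S.r = 0 := by
  obtain ⟨R, hR0, hR⟩ := hK.isBounded.exists_pos_norm_lt
  exact ⟨{ a := ((-R - 2 : ℝ) : ℂ), b := 0, r := 0, ρ := R, c := -R - 1, δ := 1
           r_nonneg := le_rfl
           ρ_nonneg := hR0.le
           δ_pos := one_pos
           re_le := fun z hz => by
             have := (abs_le.1 (abs_re_sub_le_of_mem_closedBall hz)).2
             rw [Complex.ofReal_re] at this
             linarith
           le_re := fun z hz => by
             have := (abs_le.1 (abs_re_sub_le_of_mem_closedBall hz)).1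
             rw [Complex.zero_re] at this
             linarith
           subset_union := fun z hz => .inr (by simpa using hR z hz)
           analyticAt_left := fun t z _ => analyticAt_expMinus t z
           analyticAt_right := fun t z _ => analyticAt_expMinus t z
           eq_left := fun _ h => absurd rfl h
           eq_right := fun _ _ _ _ => rfl }, rfl⟩

theorem nonempty_expSplit_greenFun {K : Set ℂ} (hK : IsCompact K)
    (h0 : Disjoint K {z : ℂ | z.re = 0}) : Nonempty (ExpSplit greenFun K) := by
  obtain ⟨M, hM0, hM⟩ := hK.isBounded.exists_pos_norm_lt
  obtain ⟨δ, hδ, hδK⟩ : ∃ δ : ℝ, 0 < δ ∧ ∀ z ∈ K, 2 * δ ≤ |z.re| := by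
    rcases K.eq_empty_or_nonempty with rfl | hne
    · exact ⟨1, one_pos, by simp⟩
    · obtain ⟨z₀, hz₀, hmin⟩ := hK.exists_isMinOn hne
        (f := fun z : ℂ => |z.re|) (by fun_prop)
      have : 0 < |z₀.re| := abs_pos.2 fun h => h0.le_bot ⟨hz₀, h⟩
      refine ⟨|z₀.re| / 2, by positivity, fun z hz => ?_⟩
      rw [mul_div_cancel₀ _ two_ne_zero]
      exact hmin hz
  -- The discs have centres `∓q` and radius `q - δ`, so they stay at distance `δ` from the axis. For
  -- `‖z‖ < M` and `Re z ≤ -2δ` one has `‖z + q‖² < M² - 4δq + q²`, and `M² = 2δ(q - δ)` makes the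
  -- right side smaller than `(q - δ)²`; the right half is symmetric.
  set q : ℝ := M ^ 2 / (2 * δ) + δ with hq
  have hqδ : δ < q := lt_add_of_pos_left δ (by positivity)
  have hqM : M ^ 2 = 2 * δ * (q - δ) := by rw [hq]; field_simp; ring
  have hsq : ∀ z : ℂ, ‖z‖ ^ 2 = z.re ^ 2 + z.im ^ 2 := fun z => by
    rw [← Complex.normSq_eq_norm_sq, Complex.normSq_apply]; ring
  have hleft : ∀ z ∈ Metric.closedBall ((-q : ℝ) : ℂ) (q - δ), z.re ≤ 0 - δ := fun z hz => by
    have := (abs_le.1 (abs_re_sub_le_of_mem_closedBall hz)).2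
    rw [Complex.ofReal_re] at this
    linarith
  have hright : ∀ z ∈ Metric.closedBall (q : ℂ) (q - δ), 0 + δ ≤ z.re := fun z hz => by
    have := (abs_le.1 (abs_re_sub_le_of_mem_closedBall hz)).1
    rw [Complex.ofReal_re] at this
    linarith
  exact ⟨{
    a := ((-q : ℝ) : ℂ), b := q, r := q - δ, ρ := q - δ, c := 0, δ := δ
    r_nonneg := sub_nonneg.2 hqδ.le
    ρ_nonneg := sub_nonneg.2 hqδ.le
    δ_pos := hδ
    re_le := hleft
    le_re := hright
    subset_union := fun z hz => by
      have h1 := hδK z hz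
      have h2 : ‖z‖ ^ 2 < M ^ 2 := pow_lt_pow_left₀ (hM z hz) (norm_nonneg _) two_ne_zero
      rw [hsq] at h2
      rcases le_total z.re 0 with h | h
      · left
        rw [abs_of_nonpos h] at h1
        rw [mem_ball_iff_norm]
        refine lt_of_pow_lt_pow_left₀ 2 (sub_nonneg.2 hqδ.le) ?_
        rw [hsq]
        simp only [Complex.sub_re, Complex.sub_im, Complex.ofReal_re, Complex.ofReal_im]
        nlinarith
      · right
        rw [abs_of_nonneg h] at h1
        rw [mem_ball_iff_norm]
        refine lt_of_pow_lt_pow_left₀ 2 (sub_nonneg.2 hqδ.le) ?_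
        rw [hsq]
        simp only [Complex.sub_re, Complex.sub_im, Complex.ofReal_re, Complex.ofReal_im]
        nlinarith
    analyticAt_left := fun t z hz => (analyticAt_expPlus t z).congr <| by
      have hz' : z.re < 0 := (hleft z hz).trans_lt (by linarith)
      filter_upwards [(isOpen_lt Complex.continuous_re continuous_const).mem_nhds hz'] with w hw
      exact (greenFun_of_re_neg t hw).symm
    analyticAt_right := fun t z hz => (analyticAt_expMinus t z).congr <| by
      have hz' : 0 < z.re := lt_of_lt_of_le (by linarith) (hright z hz)
      filter_upwards [(isOpen_lt continuous_const Complex.continuous_re).mem_nhds hz'] with w hw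
      exact (greenFun_of_re_pos t hw).symm
    eq_left := fun t _ z hz => greenFun_of_re_neg t
      ((hleft z (Metric.sphere_subset_closedBall hz)).trans_lt (by linarith))
    eq_right := fun t _ z hz => greenFun_of_re_pos t
      (lt_of_lt_of_le (by linarith) (hright z (Metric.sphere_subset_closedBall hz))) }⟩

end

theorem theoremt {X : Type*} [NormedAddCommGroup X] [NormedSpace ℂ X] [CompleteSpace X]
    {n : ℕ} (D : BlockDecomp X n) (A : D.causal)
    {k : ℕ} (idx : Fin (k + 1) → Fin n) (hidx : StrictAnti idx) :
    (∀ t : ℝ, 0 < t →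
      Integrable (D.convIntegrand expPlus A idx t) ∧
      D.HasDividedDifference (expPlus t) A idx
        (iterIntegralPos k (D.convIntegrand expPlus A idx t) t)) ∧
    (∀ t : ℝ, t < 0 →
      Integrable (D.convIntegrand expMinus A idx t) ∧
      D.HasDividedDifference (expMinus t) A idx
        (iterIntegralNeg k (D.convIntegrand expMinus A idx t) t)) ∧
    (Disjoint (spectrum ℂ (A : X →L[ℂ] X)) {z : ℂ | z.re = 0} →
      ∀ t : ℝ, t ≠ 0 →
        Integrable (D.convIntegrand greenFun A idx t) ∧
        D.HasDividedDifference (greenFun t) A idx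
          (iterIntegral k (D.convIntegrand greenFun A idx t))) := by
  have hK := D.isCompact_causal_spectrum A
  refine ⟨fun t ht => ?_, fun t ht => ?_, fun h t ht => ?_⟩
  · obtain ⟨S, hS⟩ := exists_expSplit_expPlus hK
    have h := D.iterIntegralPos_convIntegrand A S hS idx ht (ContinuousLinearMap.id ℂ _)
    exact ⟨D.integrable_convIntegrand A S idx t, h ▸ D.hasDividedDifference A S idx t⟩
  · obtain ⟨S, hS⟩ := exists_expSplit_expMinus hK
    have h := D.iterIntegralNeg_convIntegrand A S hS idx ht (ContinuousLinearMap.id ℂ _)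
    exact ⟨D.integrable_convIntegrand A S idx t, h ▸ D.hasDividedDifference A S idx t⟩
  · obtain ⟨S⟩ := nonempty_expSplit_greenFun hK (D.disjoint_causal_spectrum A h)
    have h := D.iterIntegral_convIntegrand A S idx ht (ContinuousLinearMap.id ℂ _)
    exact ⟨D.integrable_convIntegrand A S idx t, h ▸ D.hasDividedDifference A S idx t⟩
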